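/- Identify $\mathbb{R}^4$ with the skew field $\mathbb{H}$ of quaternions, $\mathbb{R}^3$ with the set $\mathrm{Im}\,\mathbb{H}$ of purely imaginary quaternions $xi+yj+zk$, and $S^3$ with the set of unit quaternions. Let $\mathbb{H}_{11}$ be the set of polynomials in two variables $u,v$ (commuting with each other and with the coefficients) with quaternionic coefficients, of degree at most $1$ in $u$ and at most $1$ in $v$. Let $A,B,C\in\mathbb{H}_{11}$ be such that $AC\in\mathbb{H}_{11}$. Let $U\subset\mathbb{R}^2$ be an open set on which $A$ and $C$ have no zeros, and put $$\Phi(u,v)=A(u,v)^{-1}B(u,v)\,C(u,v)^{-1},\qquad (u,v)\in U.$$ Assume that the differential of $\Phi$ is injective at some point of $U$ (for instance, that $U$ is a nonempty planar domain and $\Phi$ is an injective immersion on $U$). 1. If $\Phi(U)\subset\mathbb{R}^3$, then $\Phi(U)$ is a subset of a Darboux cyclide or of a Euclidean translational surface. Here a Darboux cyclide is a set of all $(x,y,z)\in\mathbb{R}^3$ satisfying $$a(x^2+y^2+z^2)^2+(x^2+y^2+z^2)(bx+cy+dz)+Q(x,y,z)=0,$$ where $a,b,c,d\in\mathbb{R}$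 and the polynomial $Q\in\mathbb{R}[x,y,z]$ of degree at most $2$ do not all vanish; a Euclidean translational surface is a set $\{p+q: p\in\alpha,\ q\in\beta\}$, where $\alpha,\beta$ are two circles in $\mathbb{R}^3$ not lying in parallel (or equal) planes. 2. If $\Phi(U)\subset S^3$, then $\Phi(U)$ is a subset of the intersection of $S^3$ with another $3$-dimensional quadric or of a Clifford translational surface. Here "another quadric" is the zero set in $\mathbb{R}^4$ of a polynomial of degree $2$ which does not vanish identically on $S^3$; a Clifford translational surface is a set $\{p\cdot q: p\in\alpha,\ q\in\beta\}$, where $\alpha,\beta$ are two circles in $S^3$ and the product is that of quaternions. Circles are genuine circles of positive radius. -/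

import Mathlib

noncomputable section

namespace TwoCircles

/-- The skew field of quaternions, identified with `ℝ⁴`. Mathlib's norm and inner product on it are
the Euclidean ones. -/
abbrev HH : Type := Quaternion ℝ

/-- The ring `ℍ[u,v]` of polynomials with quaternionic coefficients in two variables which commute
with each other and with the coefficients. The inner variable is `u`, the outer variable is `v`. -/
abbrev HPoly : Type := Polynomial (Polynomial HH)

/-- `ℍ_{mn}`: the polynomials of degree at most `m` in `u` and at most `n` in `v`. -/
def HDeg (m n : ℕ) : Set HPoly :=
  {P | P.natDegree ≤ n ∧ ∀ j, (P.coeff j).natDegree ≤ m}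

/-- The value `P(u,v)` at a pair of real numbers `p = (u, v)`. -/
def value (P : HPoly) (p : ℝ × ℝ) : HH :=
  (P.eval (Polynomial.C (p.2 : HH))).eval (p.1 : HH)

/-- The map `Φ(u,v) = A(u,v)⁻¹ B(u,v) C(u,v)⁻¹`. -/
def surfaceMap (A B C : HPoly) (p : ℝ × ℝ) : HH :=
  (value A p)⁻¹ * value B p * (value C p)⁻¹

/-- `ℝ³ = Im ℍ`, the purely imaginary quaternions. -/
def imH : Set HH := {q | q.re = 0}

/-- `S³`, the unit quaternions. -/
def sphere3 : Set HH := {q | ‖q‖ = 1}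

/-- Circles (of positive radius) in `ℝ⁴ = ℍ`. -/
def IsCircle (K : Set HH) : Prop :=
  ∃ (c e₁ e₂ : HH) (r : ℝ), 0 < r ∧ ‖e₁‖ = 1 ∧ ‖e₂‖ = 1 ∧ inner ℝ e₁ e₂ = 0 ∧
    K = {p | ∃ t : ℝ, p = c + (r * Real.cos t) • e₁ + (r * Real.sin t) • e₂}

/-- Darboux cyclides in `ℝ³ = Im ℍ` with the coordinates `x, y, z` of `x i + y j + z k`. -/
def IsDarbouxCyclide (S : Set HH) : Prop :=
  ∃ (a b c d : ℝ) (Q : MvPolynomial (Fin 3) ℝ), Q.totalDegree ≤ 2 ∧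
    ¬ (a = 0 ∧ b = 0 ∧ c = 0 ∧ d = 0 ∧ Q = 0) ∧
    S = {q | q ∈ imH ∧
      a * (q.imI ^ 2 + q.imJ ^ 2 + q.imK ^ 2) ^ 2
        + (q.imI ^ 2 + q.imJ ^ 2 + q.imK ^ 2) * (b * q.imI + c * q.imJ + d * q.imK)
        + MvPolynomial.eval ![q.imI, q.imJ, q.imK] Q = 0}

/-- Euclidean translational surfaces `{p + q : p ∈ α, q ∈ β}`, where `α` and `β` are circles in
`ℝ³ = Im ℍ`. The circles do not lie in parallel planes (otherwise the set would be a part of a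
plane). -/
def IsEuclideanTranslational (S : Set HH) : Prop :=
  ∃ α β : Set HH, IsCircle α ∧ IsCircle β ∧ α ⊆ imH ∧ β ⊆ imH ∧
    vectorSpan ℝ α ≠ vectorSpan ℝ β ∧
    S = {x | ∃ p ∈ α, ∃ q ∈ β, x = p + q}

/-- Clifford translational surfaces `{p q : p ∈ α, q ∈ β}` in `S³`, where `α` and `β` are circles
in `S³`. -/
def IsCliffordTranslational (S : Set HH) : Prop :=
  ∃ α β : Set HH, IsCircle α ∧ IsCircle β ∧ α ⊆ sphere3 ∧ β ⊆ sphere3 ∧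
    S = {x | ∃ p ∈ α, ∃ q ∈ β, x = p * q}

/-- Quadrics (quadratic hypersurfaces) in `ℝ⁴ = ℍ`. -/
def IsQuadric (X : Set HH) : Prop :=
  ∃ P : MvPolynomial (Fin 4) ℝ, P.totalDegree = 2 ∧
    X = {q | MvPolynomial.eval ![q.re, q.imI, q.imJ, q.imK] P = 0}

/-- Intersections of `S³` with another quadric, that is, with one that does not contain `S³`. -/
def IsSphereQuadricSection (S : Set HH) : Prop :=
  ∃ X : Set HH, IsQuadric X ∧ ¬ sphere3 ⊆ X ∧ S = sphere3 ∩ X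

end TwoCircles

end

noncomputable section

open scoped Quaternion

namespace TwoCircles

/-! Since `A * C` has no terms with `u²` or `v²` and `ℍ` has no zero divisors, either one of `A`,
`C` is constant, or one depends on `u` only and the other on `v` only (`bicoeff_cases`). Absorbing
constants, moving real factors across and changing the parameters by real affine maps leaves two
kinds of surfaces (`reduction`): one-sided fractions `A⁻¹B`, `BC⁻¹`, and normal forms `(u + a)⁻¹ B
(v + c)⁻¹` with imaginary units `a`, `c`.

For `A⁻¹B` in `S³` one has `|A| = |B|` on `U`, so as a quadratic form in the monomials `m = (1, u,
v, uv)` the difference `|A|² - |B|²` equals `λ(m₀m₃ - m₁m₂)`. If `λ = 0`, then `B` is the image of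
`A` under a linear isometry, `x ↦ pxq` or `x ↦ px̄q`, and a quadric can be written down
(`inQuadric_conjugation`, `inQuadric_anticonjugation`). If `λ ≠ 0`, then `AΦ = B` makes the four
vectors `aᵢΦ - bᵢ` linearly dependent; on `S³` their determinant is quadratic in `Φ`, and it is not
identically zero for reasons of dimension (`inQuadric_of_nondegenerate`). Conjugation handles
`BC⁻¹`. The Cayley transform carries `ℝ³` into `S³`, preserves one-sided fractions and pulls quadric
sections back to Darboux cyclides (`IsQuadFun.exists_cyclide`).

For normal forms the condition on `Φ` is a biquadratic identity in `u`, `v`, hence nine equations on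
the coefficients of `B`. In `ℝ³`, divide `B` by `u + a` on the left and by `v + c` on the right: if
`a`, `c` do not commute, the remainder vanishes and `Φ` is a sum of points of two circles; otherwise
`Φ` is planar. In `S³`, `B` factors as `(u + b₂)(v + b₁)k`, which gives a product of two circles, or
as `(v + b₁)(u + b₂)k`, where both parameters can be eliminated and a quadric remains
(`inQuadric_commutator`). Regularity of `Φ` excludes circles of radius zero. -/

/-! ### Polynomial functions of degree at most one and two on `ℍ`. -/

/-- The real coordinates of a quaternion. -/
def coords (q : HH) : Fin 4 → ℝ := ![q.re, q.imI, q.imJ, q.imK]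

/-- Real polynomial functions of degree at most one on `ℍ = ℝ⁴`. -/
def IsAffineFun (f : HH → ℝ) : Prop :=
  ∃ (c : ℝ) (l : Fin 4 → ℝ), ∀ q, f q = c + ∑ i, l i * coords q i

/-- Real polynomial functions of degree at most two on `ℍ = ℝ⁴`. -/
def IsQuadFun (f : HH → ℝ) : Prop :=
  ∃ (c : ℝ) (l : Fin 4 → ℝ) (k : Fin 4 → Fin 4 → ℝ), ∀ q,
    f q = c + ∑ i, l i * coords q i + ∑ i, ∑ j, k i j * (coords q i * coords q j)

theorem IsAffineFun.const (c : ℝ) : IsAffineFun fun _ => c := ⟨c, 0, by simp⟩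

theorem IsAffineFun.coord (i : Fin 4) : IsAffineFun fun q => coords q i :=
  ⟨0, Pi.single i 1, fun q => by simp [Pi.single_apply]⟩

theorem IsAffineFun.add {f g : HH → ℝ} (hf : IsAffineFun f) (hg : IsAffineFun g) :
    IsAffineFun fun q => f q + g q := by
  obtain ⟨c, l, h⟩ := hf
  obtain ⟨c', l', h'⟩ := hg
  refine ⟨c + c', l + l', fun q => ?_⟩
  beta_reduce
  rw [h, h']
  simp only [Pi.add_apply, add_mul, Finset.sum_add_distrib]
  ring

theorem IsAffineFun.const_mul {f : HH → ℝ} (r : ℝ) (hf : IsAffineFun f) :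
    IsAffineFun fun q => r * f q := by
  obtain ⟨c, l, h⟩ := hf
  refine ⟨r * c, fun i => r * l i, fun q => ?_⟩
  beta_reduce
  rw [h, mul_add, Finset.mul_sum]
  simp only [mul_assoc]

theorem IsAffineFun.neg {f : HH → ℝ} (hf : IsAffineFun f) : IsAffineFun fun q => - f q := by
  simpa using hf.const_mul (-1)

theorem IsAffineFun.sub {f g : HH → ℝ} (hf : IsAffineFun f) (hg : IsAffineFun g) :
    IsAffineFun fun q => f q - g q := by
  simpa [sub_eq_add_neg] using hf.add hg.neg

theorem IsAffineFun.isQuadFun {f : HH → ℝ} (hf : IsAffineFun f) : IsQuadFun f := by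
  obtain ⟨c, l, h⟩ := hf
  exact ⟨c, l, 0, fun q => by simp [h]⟩

theorem IsQuadFun.add {f g : HH → ℝ} (hf : IsQuadFun f) (hg : IsQuadFun g) :
    IsQuadFun fun q => f q + g q := by
  obtain ⟨c, l, k, h⟩ := hf
  obtain ⟨c', l', k', h'⟩ := hg
  refine ⟨c + c', l + l', k + k', fun q => ?_⟩
  beta_reduce
  rw [h, h']
  simp only [Pi.add_apply, add_mul, Finset.sum_add_distrib]
  ring

theorem IsQuadFun.const_mul {f : HH → ℝ} (r : ℝ) (hf : IsQuadFun f) :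
    IsQuadFun fun q => r * f q := by
  obtain ⟨c, l, k, h⟩ := hf
  refine ⟨r * c, fun i => r * l i, fun i j => r * k i j, fun q => ?_⟩
  beta_reduce
  rw [h]
  simp only [mul_add, Finset.mul_sum, mul_assoc]

theorem IsQuadFun.sub {f g : HH → ℝ} (hf : IsQuadFun f) (hg : IsQuadFun g) :
    IsQuadFun fun q => f q - g q := by
  simpa [sub_eq_add_neg] using hf.add (hg.const_mul (-1))

theorem IsQuadFun.sum {ι : Type*} (s : Finset ι) {f : ι → HH → ℝ}
    (hf : ∀ i ∈ s, IsQuadFun (f i)) : IsQuadFun fun q => ∑ i ∈ s, f i q := by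
  classical
  induction s using Finset.induction_on with
  | empty => simpa using (IsAffineFun.const 0).isQuadFun
  | insert a s ha ih =>
    simp only [Finset.sum_insert ha]
    exact (hf a (by simp)).add (ih fun i hi => hf i (by simp [hi]))

theorem IsAffineFun.mul {f g : HH → ℝ} (hf : IsAffineFun f) (hg : IsAffineFun g) :
    IsQuadFun fun q => f q * g q := by
  obtain ⟨c, l, h⟩ := hf
  obtain ⟨c', l', h'⟩ := hg
  refine ⟨c * c', fun i => c * l' i + c' * l i, fun i j => l i * l' j, fun q => ?_⟩
  beta_reduce
  rw [h, h', add_mul, mul_add, mul_add, Finset.sum_mul_sum]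
  simp only [add_mul, Finset.sum_add_distrib, Finset.mul_sum, Finset.sum_mul]
  have e1 : ∀ i j, l i * coords q i * (l' j * coords q j)
      = l i * l' j * (coords q i * coords q j) := fun i j => by ring
  have e2 : ∀ i, l i * coords q i * c' = c' * l i * coords q i := fun i => by ring
  simp only [e1, e2, mul_assoc]
  ring

/-- Quaternion-valued maps on `ℍ = ℝ⁴` whose coordinates are of degree at most one. -/
def IsAffineMap (M : HH → HH) : Prop := ∀ i, IsAffineFun fun q => coords (M q) i

theorem isAffineMap_iff {M : HH → HH} : IsAffineMap M ↔
    (IsAffineFun fun q => (M q).re) ∧ (IsAffineFun fun q => (M q).imI) ∧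
    (IsAffineFun fun q => (M q).imJ) ∧ (IsAffineFun fun q => (M q).imK) := by
  simp only [IsAffineMap, Fin.forall_fin_succ, coords]
  simp

theorem IsAffineMap.id : IsAffineMap fun q => q := fun i => IsAffineFun.coord i

theorem IsAffineMap.const (c : HH) : IsAffineMap fun _ => c := fun _ => IsAffineFun.const _

theorem IsAffineMap.add {M N : HH → HH} (hM : IsAffineMap M) (hN : IsAffineMap N) :
    IsAffineMap fun q => M q + N q := by
  rw [isAffineMap_iff] at *
  simp only [Quaternion.re_add, Quaternion.imI_add, Quaternion.imJ_add, Quaternion.imK_add]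
  exact ⟨hM.1.add hN.1, hM.2.1.add hN.2.1, hM.2.2.1.add hN.2.2.1, hM.2.2.2.add hN.2.2.2⟩

theorem IsAffineMap.const_mul {M : HH → HH} (a : HH) (hM : IsAffineMap M) :
    IsAffineMap fun q => a * M q := by
  rw [isAffineMap_iff] at *
  obtain ⟨h1, h2, h3, h4⟩ := hM
  simp only [Quaternion.re_mul, Quaternion.imI_mul, Quaternion.imJ_mul, Quaternion.imK_mul]
  exact ⟨(((h1.const_mul _).sub (h2.const_mul _)).sub (h3.const_mul _)).sub (h4.const_mul _),
    (((h2.const_mul _).add (h1.const_mul _)).add (h4.const_mul _)).sub (h3.const_mul _),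
    (((h3.const_mul _).sub (h4.const_mul _)).add (h1.const_mul _)).add (h2.const_mul _),
    (((h4.const_mul _).add (h3.const_mul _)).sub (h2.const_mul _)).add (h1.const_mul _)⟩

theorem IsAffineMap.star {M : HH → HH} (hM : IsAffineMap M) :
    IsAffineMap fun q => star (M q) := by
  rw [isAffineMap_iff] at *
  obtain ⟨h1, h2, h3, h4⟩ := hM
  simp only [Quaternion.re_star, Quaternion.imI_star, Quaternion.imJ_star, Quaternion.imK_star]
  exact ⟨h1, h2.neg, h3.neg, h4.neg⟩

theorem IsAffineMap.mul_const {M : HH → HH} (a : HH) (hM : IsAffineMap M) :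
    IsAffineMap fun q => M q * a := by
  simpa using (hM.star.const_mul (Star.star a)).star

theorem IsAffineMap.sub {M N : HH → HH} (hM : IsAffineMap M) (hN : IsAffineMap N) :
    IsAffineMap fun q => M q - N q := by
  simpa [sub_eq_add_neg] using hM.add (hN.const_mul (-1))

theorem IsAffineMap.re {M : HH → HH} (hM : IsAffineMap M) : IsAffineFun fun q => (M q).re :=
  (isAffineMap_iff.1 hM).1

theorem IsAffineMap.re_mul {M N : HH → HH} (hM : IsAffineMap M) (hN : IsAffineMap N) :
    IsQuadFun fun q => (M q * N q).re := by
  rw [isAffineMap_iff] at *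
  simp only [Quaternion.re_mul]
  exact (((hM.1.mul hN.1).sub (hM.2.1.mul hN.2.1)).sub (hM.2.2.1.mul hN.2.2.1)).sub
    (hM.2.2.2.mul hN.2.2.2)

theorem IsQuadFun.comp {f : HH → ℝ} {M : HH → HH} (hf : IsQuadFun f) (hM : IsAffineMap M) :
    IsQuadFun fun q => f (M q) := by
  obtain ⟨c, l, k, h⟩ := hf
  simp only [h]
  refine ((IsAffineFun.const c).isQuadFun.add (IsQuadFun.sum _ fun i _ => ?_)).add
    (IsQuadFun.sum _ fun i _ => IsQuadFun.sum _ fun j _ => ?_)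
  · exact ((hM i).const_mul _).isQuadFun
  · exact ((hM i).mul (hM j)).const_mul _

theorem continuous_coords (i : Fin 4) : Continuous fun q => coords q i := by
  fin_cases i
  · exact Quaternion.continuous_re
  · exact Quaternion.continuous_imI
  · exact Quaternion.continuous_imJ
  · exact Quaternion.continuous_imK

theorem IsQuadFun.continuous {f : HH → ℝ} (hf : IsQuadFun f) : Continuous f := by
  obtain ⟨c, l, k, h⟩ := hf
  rw [funext h]
  have := continuous_coords
  fun_prop

/-! ### Quadric sections of `S³`. -/

theorem mem_sphere3_iff {q : HH} : q ∈ sphere3 ↔ Quaternion.normSq q = 1 := by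
  rw [Quaternion.normSq_eq_norm_mul_self]
  constructor
  · intro h
    rw [show ‖q‖ = 1 from h, mul_one]
  · intro h
    exact (mul_self_eq_one_iff.1 h).resolve_right (by linarith [norm_nonneg q])

/-- Sets of zeros of a polynomial function of degree at most two which does not vanish identically
on `S³`. -/
def InQuadric (V : Set HH) : Prop :=
  ∃ f : HH → ℝ, IsQuadFun f ∧ (∃ q ∈ sphere3, f q ≠ 0) ∧ ∀ x ∈ V, f x = 0

open MvPolynomial in
/-- The polynomial of degree at most two with given coefficients. -/
def quadPoly {n : ℕ} (c : ℝ) (l : Fin n → ℝ) (k : Fin n → Fin n → ℝ) : MvPolynomial (Fin n) ℝ :=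
  C c + ∑ i, C (l i) * X i + ∑ i, ∑ j, C (k i j) * (X i * X j)

open MvPolynomial in
theorem totalDegree_quadPoly {n : ℕ} (c : ℝ) (l : Fin n → ℝ) (k : Fin n → Fin n → ℝ) :
    (quadPoly c l k).totalDegree ≤ 2 := by
  refine (totalDegree_add _ _).trans (max_le ((totalDegree_add _ _).trans (max_le ?_ ?_)) ?_)
  · simp
  · refine totalDegree_finsetSum_le fun i _ => ?_
    refine (totalDegree_mul _ _).trans ?_
    simp [totalDegree_X]
  · refine totalDegree_finsetSum_le fun i _ => totalDegree_finsetSum_le fun j _ => ?_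
    refine (totalDegree_mul _ _).trans ?_
    have := totalDegree_mul (X i : MvPolynomial (Fin n) ℝ) (X j)
    simp only [totalDegree_X, totalDegree_C] at *
    omega

theorem eval_quadPoly {n : ℕ} (c : ℝ) (l : Fin n → ℝ) (k : Fin n → Fin n → ℝ) (x : Fin n → ℝ) :
    MvPolynomial.eval x (quadPoly c l k) =
      c + ∑ i, l i * x i + ∑ i, ∑ j, k i j * (x i * x j) := by
  simp [quadPoly]

open MvPolynomial in
theorem InQuadric.exists_section {V : Set HH} (hV : InQuadric V) (hS : V ⊆ sphere3) :
    ∃ S, IsSphereQuadricSection S ∧ V ⊆ S := by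
  obtain ⟨f, ⟨c, l, k, hf⟩, ⟨q, hq, hq0⟩, hz⟩ := hV
  obtain ⟨P, hP, hfP⟩ : ∃ P : MvPolynomial (Fin 4) ℝ, P.totalDegree ≤ 2 ∧
      ∀ q, f q = eval (coords q) P :=
    ⟨quadPoly c l k, totalDegree_quadPoly c l k, fun q => by rw [hf, eval_quadPoly]⟩
  obtain ⟨P', hP', hPP'⟩ : ∃ P' : MvPolynomial (Fin 4) ℝ, P'.totalDegree = 2 ∧
      ∀ q ∈ sphere3, eval (coords q) P' = eval (coords q) P := by
    rcases hP.eq_or_lt with h2 | h2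
    · exact ⟨P, h2, fun _ _ => rfl⟩
    -- A quadric needs degree exactly two. `N` vanishes on `S³`, so adding it changes nothing there,
    -- and it contributes the term `X₀²`, which `P` of degree below two cannot cancel.
    · set N : MvPolynomial (Fin 4) ℝ := ∑ i, X i ^ 2 - C 1 with hN
      have hNdeg : N.totalDegree ≤ 2 := by
        refine (totalDegree_sub _ _).trans (max_le (totalDegree_finsetSum_le fun i _ => ?_) ?_)
        · simp
        · simp
      refine ⟨P + N, le_antisymm ((totalDegree_add _ _).trans (max_le hP hNdeg)) ?_, ?_⟩
      · by_contra! hlt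
        have h1 := coeff_eq_zero_of_totalDegree_lt (f := P + N)
          (d := Finsupp.single 0 2) (by simpa using hlt)
        have h3 := coeff_eq_zero_of_totalDegree_lt (f := P)
          (d := Finsupp.single 0 2) (by simpa using h2)
        have h0 : (0 : Fin 4 →₀ ℕ) ≠ Finsupp.single 0 2 := fun h => by
          simpa using DFunLike.congr_fun h 0
        rw [coeff_add, h3, hN] at h1
        simp [coeff_X_pow, Fin.sum_univ_four, coeff_one, h0, Finsupp.single_eq_single_iff] at h1
      · intro q hq
        rw [mem_sphere3_iff, Quaternion.normSq_def'] at hq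
        simp [hN, Fin.sum_univ_four, coords, hq]
  refine ⟨sphere3 ∩ {q | eval ![q.re, q.imI, q.imJ, q.imK] P' = 0},
    ⟨_, ⟨P', hP', rfl⟩, fun hsub => hq0 ?_, rfl⟩, fun x hx => ⟨hS hx, ?_⟩⟩
  · rw [hfP, ← hPP' q hq]
    exact hsub hq
  · change eval (coords x) P' = 0
    rw [hPP' x (hS hx), ← hfP]
    exact hz x hx

theorem InQuadric.of_star {V : Set HH} (hV : InQuadric (star '' V)) : InQuadric V := by
  obtain ⟨f, hf, ⟨q, hq, hq0⟩, hz⟩ := hV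
  refine ⟨fun q => f (star q), hf.comp IsAffineMap.id.star, ⟨star q, ?_, by simpa using hq0⟩,
    fun x hx => hz _ ⟨x, hx, rfl⟩⟩
  rwa [mem_sphere3_iff, Quaternion.normSq_star, ← mem_sphere3_iff]

/-! ### Linear isometries of `ℍ` as quaternionic multiplications. -/

/-- The maps `x ↦ p x q` and `x ↦ p x̄ q` with unit quaternions `p` and `q`. -/
def IsUnitMul (T : HH → HH) : Prop :=
  ∃ p q : HH, Quaternion.normSq p = 1 ∧ Quaternion.normSq q = 1 ∧
    ((∀ x, T x = p * x * q) ∨ ∀ x, T x = p * star x * q)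

theorem isUnitMul_id : IsUnitMul fun x => x := ⟨1, 1, by simp, by simp, Or.inl fun x => by simp⟩

theorem IsUnitMul.comp {S T : HH → HH} (hS : IsUnitMul S) (hT : IsUnitMul T) :
    IsUnitMul fun x => S (T x) := by
  obtain ⟨p, q, hp, hq, h | h⟩ := hS <;> obtain ⟨p', q', hp', hq', h' | h'⟩ := hT
  · exact ⟨p * p', q' * q, by simp [*], by simp [*], Or.inl fun x => by simp [h, h', mul_assoc]⟩
  · exact ⟨p * p', q' * q, by simp [*], by simp [*], Or.inr fun x => by simp [h, h', mul_assoc]⟩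
  · exact ⟨p * star q', star p' * q, by simp [*], by simp [*],
      Or.inr fun x => by simp [h, h', mul_assoc]⟩
  · exact ⟨p * star q', star p' * q, by simp [*], by simp [*],
      Or.inl fun x => by simp [h, h', mul_assoc]⟩

/-- For a unit `v` the reflection in its orthogonal complement is `x ↦ -v x̄ v`; for `v = 0` it is
the identity. -/
theorem isUnitMul_reflection (v : HH) : IsUnitMul ((Submodule.span ℝ {v})ᗮ.reflection) := by
  have key : ∀ x, (Submodule.span ℝ {v})ᗮ.reflection x
      = x - (2 * (inner ℝ v x / ‖v‖ ^ 2)) • v := fun x => by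
    rw [Submodule.reflection_orthogonal_apply, Submodule.reflection_singleton_apply, neg_sub,
      ← Nat.cast_smul_eq_nsmul ℝ, smul_smul]
    simp
  rcases eq_or_ne v 0 with rfl | hv
  · convert isUnitMul_id using 1
    funext x
    rw [key, smul_zero, sub_zero]
  · have hv' : ‖v‖ ≠ 0 := norm_ne_zero_iff.2 hv
    have hs : ‖v‖ ^ 2 = v.re ^ 2 + v.imI ^ 2 + v.imJ ^ 2 + v.imK ^ 2 := by
      rw [sq, ← Quaternion.normSq_eq_norm_mul_self, Quaternion.normSq_def']
    have hn : Quaternion.normSq (‖v‖⁻¹ • v) = 1 := by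
      rw [Quaternion.normSq_smul, Quaternion.normSq_eq_norm_mul_self]
      field_simp
    refine ⟨-(‖v‖⁻¹ • v), ‖v‖⁻¹ • v, by simpa using hn, hn, Or.inr fun x => ?_⟩
    have e : -(‖v‖⁻¹ • v) * star x * ‖v‖⁻¹ • v = -((‖v‖ ^ 2)⁻¹ • (v * star x * v)) := by
      simp only [neg_mul, smul_mul_assoc, mul_smul_comm, smul_neg, smul_smul]
      congr 2
      ring
    have h2 : ‖v‖ ^ 2 ≠ 0 := pow_ne_zero 2 hv'
    rw [key, e, Quaternion.inner_def]
    rw [hs] at h2 ⊢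
    ext <;> simp <;> field_simp <;> ring

/-- By Cartan–Dieudonné an isometry is a product of reflections. -/
theorem isUnitMul_of_isometry (T : HH ≃ₗᵢ[ℝ] HH) : IsUnitMul T := by
  obtain ⟨l, -, rfl⟩ := T.reflections_generate_dim
  induction l with
  | nil => exact isUnitMul_id
  | cons v l ih =>
    simp only [List.map_cons, List.prod_cons]
    exact (isUnitMul_reflection v).comp ih

/-- Two linear maps with equal norms of values differ by an isometry. -/
theorem exists_isometry {E F : Type*} [AddCommGroup E] [Module ℝ E] [NormedAddCommGroup F]
    [InnerProductSpace ℝ F] [FiniteDimensional ℝ F] (f g : E →ₗ[ℝ] F) (h : ∀ x, ‖f x‖ = ‖g x‖) :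
    ∃ T : F ≃ₗᵢ[ℝ] F, ∀ x, T (f x) = g x := by
  -- On the range of `f` the isometry is `g ∘ s` for a linear section `s`. The choice of `s` is
  -- immaterial: equal norms force `g` to vanish wherever `f` does.
  obtain ⟨s, hs⟩ := f.rangeRestrict.exists_rightInverse_of_surjective f.range_rangeRestrict
  have hs' : ∀ y : LinearMap.range f, f (s y) = y := fun y =>
    congrArg Subtype.val (LinearMap.congr_fun hs y)
  let L : LinearMap.range f →ₗᵢ[ℝ] F :=
    { toLinearMap := g ∘ₗ s
      norm_map' := fun y => by
        rw [LinearMap.comp_apply, ← h, hs']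
        rfl }
  refine ⟨L.extend.toLinearIsometryEquiv rfl, fun x => ?_⟩
  have h1 : L.extend (f x) = L ⟨f x, x, rfl⟩ := L.extend_apply ⟨f x, x, rfl⟩
  have h2 : L ⟨f x, x, rfl⟩ = g (s ⟨f x, x, rfl⟩) := rfl
  rw [LinearIsometry.coe_toLinearIsometryEquiv, h1, h2, ← sub_eq_zero, ← map_sub,
    ← norm_eq_zero, ← h, map_sub, hs', sub_self, norm_zero]

/-! ### Comparison of coefficients in biquadratic identities. -/

theorem quadratic_coeff_zero {c₀ c₁ c₂ x₀ : ℝ} {s : Set ℝ} (hs : s ∈ nhds x₀)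
    (h : ∀ x ∈ s, c₀ + c₁ * x + c₂ * x ^ 2 = 0) : c₀ = 0 ∧ c₁ = 0 ∧ c₂ = 0 := by
  obtain ⟨ε, hε, hb⟩ := Metric.mem_nhds_iff.1 hs
  have h0 := h x₀ (hb (Metric.mem_ball_self hε))
  have h1 := h (x₀ + ε / 2) (hb (by simp [Real.ball_eq_Ioo]; constructor <;> linarith))
  have h2 := h (x₀ - ε / 2) (hb (by simp [Real.ball_eq_Ioo]; constructor <;> linarith))
  -- Second difference with step `ε / 2`; the first difference then gives `c₁`.
  have e2 : c₂ * ε ^ 2 = 0 := by linear_combination 2 * (h1 + h2 - 2 * h0)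
  have z2 : c₂ = 0 := (mul_eq_zero.1 e2).resolve_right (by positivity)
  subst z2
  have e1 : c₁ * ε = 0 := by linear_combination h1 - h2
  have z1 : c₁ = 0 := (mul_eq_zero.1 e1).resolve_right (by positivity)
  subst z1
  exact ⟨by linarith, rfl, rfl⟩

theorem biquadratic_coeff_zero {U : Set (ℝ × ℝ)} (hU : IsOpen U) (hne : U.Nonempty)
    {c₀₀ c₁₀ c₂₀ c₀₁ c₁₁ c₂₁ c₀₂ c₁₂ c₂₂ : ℝ}
    (h : ∀ p ∈ U, (c₀₀ + c₁₀ * p.1 + c₂₀ * p.1 ^ 2) + (c₀₁ + c₁₁ * p.1 + c₂₁ * p.1 ^ 2) * p.2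
      + (c₀₂ + c₁₂ * p.1 + c₂₂ * p.1 ^ 2) * p.2 ^ 2 = 0) :
    (c₀₀ = 0 ∧ c₁₀ = 0 ∧ c₂₀ = 0) ∧ (c₀₁ = 0 ∧ c₁₁ = 0 ∧ c₂₁ = 0) ∧
      (c₀₂ = 0 ∧ c₁₂ = 0 ∧ c₂₂ = 0) := by
  obtain ⟨⟨u₀, v₀⟩, h0⟩ := hne
  obtain ⟨s, hs, t, ht, hst⟩ := mem_nhds_prod_iff.1 (hU.mem_nhds h0)
  have key : ∀ x ∈ s, c₀₀ + c₁₀ * x + c₂₀ * x ^ 2 = 0 ∧ c₀₁ + c₁₁ * x + c₂₁ * x ^ 2 = 0 ∧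
      c₀₂ + c₁₂ * x + c₂₂ * x ^ 2 = 0 := fun x hx =>
    quadratic_coeff_zero ht fun y hy => h (x, y) (hst ⟨hx, hy⟩)
  exact ⟨quadratic_coeff_zero hs fun x hx => (key x hx).1,
    quadratic_coeff_zero hs fun x hx => (key x hx).2.1,
    quadratic_coeff_zero hs fun x hx => (key x hx).2.2⟩

/-- Real linear combinations of four quaternions. -/
abbrev comb (b : Fin 4 → HH) : (Fin 4 → ℝ) →ₗ[ℝ] HH := Fintype.linearCombination ℝ b

/-- The value `(1, u, v, uv)` of the monomials of degree at most one in `u` and in `v`. -/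
def monomials (p : ℝ × ℝ) : Fin 4 → ℝ := ![1, p.1, p.2, p.1 * p.2]

theorem comb_apply (b : Fin 4 → HH) (m : Fin 4 → ℝ) :
    comb b m = m 0 • b 0 + m 1 • b 1 + m 2 • b 2 + m 3 • b 3 := by
  simp [comb, Fintype.linearCombination_apply, Fin.sum_univ_four]

theorem comb_monomials (b : Fin 4 → HH) (p : ℝ × ℝ) :
    comb b (monomials p) = b 0 + p.1 • b 1 + p.2 • b 2 + (p.1 * p.2) • b 3 := by
  simp [comb_apply, monomials]

theorem normSq_comb_sub (a b : Fin 4 → HH) : ∃ D : Fin 4 → Fin 4 → ℝ, ∀ m,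
    Quaternion.normSq (comb a m) - Quaternion.normSq (comb b m) =
      D 0 0 * m 0 ^ 2 + D 1 1 * m 1 ^ 2 + D 2 2 * m 2 ^ 2 + D 3 3 * m 3 ^ 2
      + D 0 1 * (m 0 * m 1) + D 0 2 * (m 0 * m 2) + D 0 3 * (m 0 * m 3)
      + D 1 2 * (m 1 * m 2) + D 1 3 * (m 1 * m 3) + D 2 3 * (m 2 * m 3) := by
  refine ⟨fun i j => (if i = j then 1 else 2) * ((a i * star (a j)).re - (b i * star (b j)).re),
    fun m => ?_⟩
  simp only [comb_apply, Quaternion.normSq_def']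
  simp
  ring

/-- The form vanishes on an open piece of the surface `(1, u, v, uv)`. Distinct products `mᵢmⱼ` give
distinct monomials in `u`, `v`, except that `m₀m₃` and `m₁m₂` both give `uv`, so only their
difference survives. -/
theorem normSq_comb_sub_eq {a b : Fin 4 → HH} {U : Set (ℝ × ℝ)} (hU : IsOpen U)
    (hne : U.Nonempty) (h : ∀ p ∈ U, Quaternion.normSq (comb a (monomials p)) =
      Quaternion.normSq (comb b (monomials p))) :
    ∃ lam : ℝ, ∀ m, Quaternion.normSq (comb a m) - Quaternion.normSq (comb b m) =
      lam * (m 0 * m 3 - m 1 * m 2) := by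
  obtain ⟨D, hD⟩ := normSq_comb_sub a b
  obtain ⟨⟨h00, h10, h20⟩, ⟨h01, h11, h21⟩, ⟨h02, h12, h22⟩⟩ :=
    biquadratic_coeff_zero (c₀₀ := D 0 0) (c₁₀ := D 0 1) (c₂₀ := D 1 1) (c₀₁ := D 0 2)
      (c₁₁ := D 0 3 + D 1 2) (c₂₁ := D 1 3) (c₀₂ := D 2 2) (c₁₂ := D 2 3) (c₂₂ := D 3 3)
      hU hne fun p hp => by
        have := hD (monomials p)
        rw [h p hp, sub_self] at this
        simp only [monomials, Matrix.cons_val] at this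
        rw [this]
        ring
  refine ⟨D 0 3, fun m => ?_⟩
  rw [hD, h00, h10, h20, h01, h21, h02, h12, h22, eq_neg_of_add_eq_zero_right h11]
  ring

theorem isAffineFun_linearMap (l : HH →ₗ[ℝ] ℝ) : IsAffineFun l := by
  obtain ⟨i, hi⟩ : ∃ i : HH, i = ⟨0, 1, 0, 0⟩ := ⟨_, rfl⟩
  obtain ⟨j, hj⟩ : ∃ j : HH, j = ⟨0, 0, 1, 0⟩ := ⟨_, rfl⟩
  obtain ⟨k, hk⟩ : ∃ k : HH, k = ⟨0, 0, 0, 1⟩ := ⟨_, rfl⟩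
  refine ⟨0, ![l 1, l i, l j, l k], fun q => ?_⟩
  have : q = q.re • 1 + q.imI • i + q.imJ • j + q.imK • k := by
    ext <;> simp <;> simp [hi, hj, hk]
  conv_lhs => rw [this]
  simp [Fin.sum_univ_four, coords]
  ring

/-! ### One-sided fractions in `S³`: the case of an isometry. -/

/-- A bilinear surface lies on a quadratic cone. -/
theorem exists_quadratic_form (x : Fin 4 → HH) : ∃ K : HH → ℝ, IsQuadFun K ∧
    (∀ (r : ℝ) y, K (r • y) = r ^ 2 * K y) ∧ (∃ y, K y ≠ 0) ∧
    ∀ p, K (comb x (monomials p)) = 0 := by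
  by_cases hx : LinearMap.range (comb x) = ⊤
  -- If the `x i` form a basis, the cone is `m₀m₃ = m₁m₂` in the coordinates of that basis.
  · have hfr : Module.finrank ℝ (Fin 4 → ℝ) = Module.finrank ℝ HH := by
      rw [Quaternion.finrank_eq_four]; simp
    have hinj : Function.Injective (comb x) :=
      (LinearMap.injective_iff_surjective_of_finrank_eq_finrank hfr).2 (LinearMap.range_eq_top.1 hx)
    let e := LinearEquiv.ofBijective (comb x) ⟨hinj, LinearMap.range_eq_top.1 hx⟩
    have hl : ∀ i, IsAffineFun fun y => e.symm y i := fun i =>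
      isAffineFun_linearMap (LinearMap.proj i ∘ₗ e.symm.toLinearMap)
    refine ⟨fun y => e.symm y 0 * e.symm y 3 - e.symm y 1 * e.symm y 2,
      ((hl 0).mul (hl 3)).sub ((hl 1).mul (hl 2)), fun r y => ?_, ⟨e ![1, 0, 0, 1], ?_⟩,
      fun p => ?_⟩
    · simp
      ring
    · simp
    · have : e.symm (comb x (monomials p)) = monomials p := e.symm_apply_apply _
      beta_reduce
      rw [this]
      simp [monomials]
  -- Otherwise the surface lies in a hyperplane `l = 0`, and `l²` serves as the form.
  · obtain ⟨l, hl0, hl⟩ := Submodule.exists_le_ker_of_lt_top _ (lt_top_iff_ne_top.2 hx)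
    obtain ⟨y, hy⟩ : ∃ y, l y ≠ 0 := by
      by_contra! h
      exact hl0 (LinearMap.ext h)
    refine ⟨fun y => l y * l y, (isAffineFun_linearMap l).mul (isAffineFun_linearMap l),
      fun r y => ?_, ⟨y, mul_ne_zero hy hy⟩, fun p => ?_⟩
    · simp
      ring
    · have : l (comb x (monomials p)) = 0 := hl ⟨_, rfl⟩
      simp only [this, mul_zero]

theorem re_mul_comm (x y : HH) : (x * y).re = (y * x).re := by
  simp
  ring

theorem star_mul_self_of_unit {q : HH} (hq : Quaternion.normSq q = 1) : star q * q = 1 := by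
  rw [Quaternion.star_mul_self, hq, Quaternion.coe_one]

theorem mul_star_self_of_unit {q : HH} (hq : Quaternion.normSq q = 1) : q * star q = 1 := by
  rw [Quaternion.self_mul_star, hq, Quaternion.coe_one]

/-- Here `Φ q̄ = A⁻¹ p A` is conjugate to `p`, so it has the same real part: the image lies in a
hyperplane. -/
theorem inQuadric_conjugation {ι : Type*} {A Φ : ι → HH} {p q : HH}
    (hq : Quaternion.normSq q = 1) (hA : ∀ i, A i ≠ 0) (h : ∀ i, A i * Φ i = p * A i * q) :
    InQuadric (Set.range Φ) := by
  refine ⟨fun y => (y * star q).re - p.re,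
    ((IsAffineMap.id.mul_const _).re.sub (IsAffineFun.const _)).isQuadFun, ?_, ?_⟩
  · by_cases hp : p.re = 1
    · refine ⟨-q, by rwa [mem_sphere3_iff, Quaternion.normSq_neg], ?_⟩
      simp only [neg_mul, mul_star_self_of_unit hq, hp]
      norm_num
    · refine ⟨q, by rwa [mem_sphere3_iff], ?_⟩
      simp only [mul_star_self_of_unit hq, Quaternion.re_one]
      exact sub_ne_zero.2 (Ne.symm hp)
  · rintro _ ⟨i, rfl⟩
    have : Φ i = (A i)⁻¹ * (p * A i * q) := by rw [← h, inv_mul_cancel_left₀ (hA i)]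
    have e : (A i)⁻¹ * (p * A i * q) * star q = (A i)⁻¹ * (p * A i) := by
      simp only [mul_assoc, mul_star_self_of_unit hq, mul_one]
    beta_reduce
    rw [this, e, re_mul_comm, mul_assoc, mul_inv_cancel₀ (hA i), mul_one, sub_self]

theorem exists_re_ne_zero {K : HH → ℝ} (hK : Continuous K) (h : ∃ y, K y ≠ 0) :
    ∃ y, K y ≠ 0 ∧ y.re ≠ 0 := by
  obtain ⟨y, hy⟩ := h
  by_cases hr : y.re = 0
  · have hc : Continuous fun t : ℝ => K (y + t) := by
      have := Quaternion.continuous_coe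
      fun_prop
    have h1 : ∀ᶠ t : ℝ in nhdsWithin 0 {0}ᶜ, K (y + t) ≠ 0 := by
      refine nhdsWithin_le_nhds (hc.continuousAt.eventually_ne ?_)
      simpa using hy
    obtain ⟨t, ht, ht0⟩ := (h1.and self_mem_nhdsWithin).exists
    exact ⟨y + t, ht, by simpa [hr] using ht0⟩
  · exact ⟨y, hy, hr⟩

/-- Put `X = A p̄`. Then `p Φ q̄ = X⁻¹ X̄`, and its conjugate plus one is `(X + X̄) X̄⁻¹ = 2 Re(X) X
/ |X|²`, a real multiple of `X`. As `X` is bilinear in the parameters, it lies on a quadratic cone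
`K = 0`, and pulling `K` back by the affine map `y ↦ 1 + conj(p y q̄)` gives the quadric. -/
theorem inQuadric_anticonjugation {ι : Type*} {a : Fin 4 → HH} {Φ : ι → HH} {P : ι → ℝ × ℝ}
    {p q : HH} (hp : Quaternion.normSq p = 1) (hq : Quaternion.normSq q = 1)
    (hA : ∀ i, comb a (monomials (P i)) ≠ 0)
    (h : ∀ i, comb a (monomials (P i)) * Φ i = p * star (comb a (monomials (P i))) * q) :
    InQuadric (Set.range Φ) := by
  obtain ⟨K, hK, hhom, hK0, hz⟩ := exists_quadratic_form fun i => a i * star p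
  have hp0 : p ≠ 0 := fun h0 => by simp [h0] at hp
  have hX : ∀ m, comb (fun i => a i * star p) m = comb a m * star p := fun m => by
    simp only [comb_apply, add_mul, smul_mul_assoc]
  refine ⟨fun y => K (1 + star (p * y * star q)),
    hK.comp ((IsAffineMap.const 1).add ((IsAffineMap.id.const_mul _).mul_const _).star), ?_, ?_⟩
  · obtain ⟨y, hy, hre⟩ := exists_re_ne_zero hK.continuous hK0
    have hy0 : Quaternion.normSq y ≠ 0 := by
      rw [Quaternion.normSq_ne_zero]
      rintro rfl
      simp at hre
    -- The witness is the point of `S³` which the affine map sends to `2 Re(y) y / |y|²`; this is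
    -- why `y` needs a nonzero real part.
    refine ⟨star p * ((Quaternion.normSq y)⁻¹ • (star y * star y)) * q, ?_, ?_⟩
    · rw [mem_sphere3_iff]
      simp only [map_mul, Quaternion.normSq_star, Quaternion.normSq_smul, hp, hq]
      field_simp
    · have e : 1 + star (p * (star p * ((Quaternion.normSq y)⁻¹ • (star y * star y)) * q) * star q)
          = (2 * y.re * (Quaternion.normSq y)⁻¹) • y := by
        have e1 : p * (star p * ((Quaternion.normSq y)⁻¹ • (star y * star y)) * q) * star q
            = (p * star p) * ((Quaternion.normSq y)⁻¹ • (star y * star y)) * (q * star q) := by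
          simp only [mul_assoc]
        rw [e1, mul_star_self_of_unit hp, mul_star_self_of_unit hq, one_mul, mul_one]
        have e2 : (Quaternion.normSq y)⁻¹ • (y * star y) = 1 := by
          rw [Quaternion.self_mul_star, ← Quaternion.coe_mul_eq_smul, ← Quaternion.coe_mul,
            inv_mul_cancel₀ hy0, Quaternion.coe_one]
        have e3 : y * star y + y * y = (2 * y.re) • y := by
          ext <;> simp <;> ring
        rw [Quaternion.star_smul, star_mul, star_star, ← e2, ← smul_add, e3, smul_smul,
          mul_comm]
      beta_reduce
      rw [e, hhom]
      exact mul_ne_zero (pow_ne_zero 2 (mul_ne_zero (mul_ne_zero two_ne_zero hre)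
        (inv_ne_zero hy0))) hy
  · rintro _ ⟨i, rfl⟩
    set A := comb a (monomials (P i)) with hAdef
    have hs : star (A * star p) ≠ 0 := by
      simpa using ⟨hp0, hA i⟩
    have e1 : star (p * Φ i * star q) * star (A * star p) = A * star p := by
      rw [← star_mul]
      have : A * star p * (p * Φ i * star q) = p * star A := by
        calc _ = A * (star p * p) * Φ i * star q := by simp only [mul_assoc]
          _ = A * Φ i * star q := by rw [star_mul_self_of_unit hp, mul_one]
          _ = p * star A * (q * star q) := by rw [h i, mul_assoc (p * _)]
          _ = p * star A := by rw [mul_star_self_of_unit hq, mul_one]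
      rw [this, star_mul, star_star]
    have e2 : 1 + star (p * Φ i * star q) =
        (2 * (A * star p).re * (Quaternion.normSq (A * star p))⁻¹) • (A * star p) := by
      refine mul_right_cancel₀ hs ?_
      rw [add_mul, e1, one_mul, smul_mul_assoc, Quaternion.self_mul_star,
        ← Quaternion.coe_mul_eq_smul, ← Quaternion.coe_mul, mul_assoc, inv_mul_cancel₀, mul_one]
      · generalize A * star p = X
        ext <;> simp
        ring
      · rw [← Quaternion.normSq_star, Quaternion.normSq_ne_zero]
        exact hs
    beta_reduce
    rw [e2, hhom, ← hX, hz, mul_zero]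

/-! ### One-sided fractions in `S³`: the determinantal quadric. -/

/-- The left side is multilinear and alternating in four vectors of `ℝ⁴`, hence a multiple of the
determinant. It involves the vectors only through products `xᵢ x̄ⱼ`, which lowers the degree of the
determinant of the pencil below from four to two. -/
theorem re_mul_eq_two_det (x : Fin 4 → HH) :
    ((x 3 * star (x 0)) * (x 1 * star (x 2)) - (x 1 * star (x 0)) * (x 3 * star (x 2))).re =
      2 * (Matrix.of fun i => coords (x i)).det := by
  rw [Matrix.det_succ_row_zero]
  simp [Fin.sum_univ_succ, Matrix.det_fin_three, coords, Fin.succAbove]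
  ring

theorem re_mul_eq_zero_iff (x : Fin 4 → HH) :
    ((x 3 * star (x 0)) * (x 1 * star (x 2)) - (x 1 * star (x 0)) * (x 3 * star (x 2))).re = 0 ↔
      ∃ m ≠ 0, comb x m = 0 := by
  rw [re_mul_eq_two_det, mul_eq_zero, or_iff_right two_ne_zero, ← Matrix.exists_vecMul_eq_zero_iff]
  refine exists_congr fun m => and_congr_right fun _ => ?_
  rw [Quaternion.ext_iff, funext_iff]
  simp [Fin.forall_fin_succ, Matrix.vecMul, dotProduct, comb_apply, coords, Fin.sum_univ_four]

/-- The entries of the pencil `aᵢ q - bᵢ`, multiplied pairwise for unit `q`. -/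
def pencilMul (a b : Fin 4 → HH) (i j : Fin 4) (q : HH) : HH :=
  a i * star (a j) + b i * star (b j) - a i * q * star (b j) - b i * star q * star (a j)

theorem isAffineMap_pencilMul (a b : Fin 4 → HH) (i j : Fin 4) :
    IsAffineMap (pencilMul a b i j) :=
  ((IsAffineMap.const _).sub ((IsAffineMap.id.const_mul _).mul_const _)).sub
    ((IsAffineMap.id.star.const_mul _).mul_const _)

/-- The only quadratic term of the product, `aᵢ q q̄ āⱼ`, is constant on `S³`; this is what makes
the product affine in `q`. -/
theorem pencilMul_eq (a b : Fin 4 → HH) (i j : Fin 4) {q : HH} (hq : Quaternion.normSq q = 1) :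
    pencilMul a b i j q = (a i * q - b i) * star (a j * q - b j) := by
  have : a i * star (a j) = a i * (q * star q) * star (a j) := by
    rw [mul_star_self_of_unit hq, mul_one]
  rw [pencilMul, this, star_sub, star_mul]
  noncomm_ring

theorem comb_pencil (a b : Fin 4 → HH) (m : Fin 4 → ℝ) (q : HH) :
    comb (fun i => a i * q - b i) m = comb a m * q - comb b m := by
  simp only [comb_apply, add_mul, smul_mul_assoc, smul_sub]
  abel

theorem exists_polar (x y : ℝ) : ∃ r θ : ℝ, x = r * Real.cos θ ∧ y = r * Real.sin θ :=
  ⟨‖(⟨x, y⟩ : ℂ)‖, Complex.arg ⟨x, y⟩, (Complex.norm_mul_cos_arg ⟨x, y⟩).symm,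
    (Complex.norm_mul_sin_arg ⟨x, y⟩).symm⟩

/-- The bilinear parametrization of the quadric `m₀ m₃ = m₁ m₂`. -/
def segre (α β : ℝ) : Fin 4 → ℝ :=
  ![Real.cos α * Real.cos β, Real.sin α * Real.cos β, Real.cos α * Real.sin β,
    Real.sin α * Real.sin β]

theorem segre_ne_zero (α β : ℝ) : segre α β ≠ 0 := by
  intro h
  have h0 := congrFun h 0
  have h1 := congrFun h 1
  have h2 := congrFun h 2
  have h3 := congrFun h 3
  simp only [segre, Matrix.cons_val, Pi.zero_apply] at h0 h1 h2 h3
  have hα := Real.sin_sq_add_cos_sq α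
  have hβ := Real.sin_sq_add_cos_sq β
  have : (Real.cos α * Real.cos β) ^ 2 + (Real.sin α * Real.cos β) ^ 2
    + (Real.cos α * Real.sin β) ^ 2 + (Real.sin α * Real.sin β) ^ 2 = 1 := by
    linear_combination (Real.sin β ^ 2 + Real.cos β ^ 2) * hα + hβ
  rw [h0, h1, h2, h3] at this
  norm_num at this

/-- The hypothesis says that a 2×2 matrix is singular, hence an outer product of two plane vectors,
which are then written in polar coordinates. -/
theorem exists_segre {m : Fin 4 → ℝ} (h : m 0 * m 3 = m 1 * m 2) :
    ∃ r α β : ℝ, m = r • segre α β := by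
  obtain ⟨x, y, s, t, h0, h1, h2, h3⟩ : ∃ x y s t : ℝ,
      m 0 = x * s ∧ m 1 = y * s ∧ m 2 = x * t ∧ m 3 = y * t := by
    by_cases h0 : m 0 = 0
    · by_cases h1 : m 1 = 0
      · exact ⟨m 2, m 3, 0, 1, by simp [h0], by simp [h1], by simp, by simp⟩
      · have h2 : m 2 = 0 := by
          rw [h0, zero_mul] at h
          exact (mul_eq_zero.1 h.symm).resolve_left h1
        exact ⟨0, m 1, 1, m 3 / m 1, by simp [h0], by simp, by simp [h2], by field_simp⟩
    · exact ⟨m 0, m 1, 1, m 2 / m 0, by simp, by simp, by field_simp, by field_simp; linarith⟩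
  obtain ⟨r, α, hx, hy⟩ := exists_polar x y
  obtain ⟨r', β, hs, ht⟩ := exists_polar s t
  refine ⟨r * r', α, β, funext fun i => ?_⟩
  fin_cases i <;> simp [segre, *] <;> ring

/-- The range of a `C¹` map from dimension three to dimension four has dense complement. -/
theorem not_surjective_of_contDiff {G : ℝ × ℝ × ℝ → HH} (hG : ContDiff ℝ 1 G) :
    ¬ Function.Surjective G := by
  intro hs
  have := hG.dense_compl_range_of_finrank_lt_finrank (by
    rw [Quaternion.finrank_eq_four]
    simp)
  rw [hs.range_eq, Set.compl_univ] at this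
  simpa using this.nonempty

theorem contDiff_comb_segre (a : Fin 4 → HH) :
    ContDiff ℝ 1 fun p : ℝ × ℝ × ℝ => comb a (segre p.2.1 p.2.2) := by
  simp only [comb_apply, segre, Matrix.cons_val]
  have := Real.contDiff_sin (n := 1)
  have := Real.contDiff_cos (n := 1)
  fun_prop

theorem inv_mul_eq_smul (x y : HH) : x⁻¹ * y = (‖x‖ ^ 2)⁻¹ • (star x * y) := by
  rw [Quaternion.inv_def, Quaternion.normSq_eq_norm_mul_self, sq, smul_mul_assoc]

theorem contDiff_star : ContDiff ℝ 1 (star : HH → HH) :=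
  (LinearMap.toContinuousLinearMap
    { toFun := star
      map_add' := star_add
      map_smul' := fun r x => Quaternion.star_smul r x : HH →ₗ[ℝ] HH }).contDiff

/-- A nonzero `m` exists exactly when the vectors `aᵢq - bᵢ` are dependent, so their determinant is
the required quadratic function. If it vanished on all of `S³`, then `|q| = 1` would force `m₀m₃ =
m₁m₂`, and every `q` would be `a(m)⁻¹ b(m)` with `m` given by two angles. With a radius added, a
`C¹` map from `ℝ³` would cover `ℍ`. -/
theorem inQuadric_of_nondegenerate {a b : Fin 4 → HH} {lam : ℝ} (hlam : lam ≠ 0)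
    (h : ∀ m, Quaternion.normSq (comb a m) - Quaternion.normSq (comb b m) =
      lam * (m 0 * m 3 - m 1 * m 2)) :
    InQuadric {q | q ∈ sphere3 ∧ ∃ m ≠ 0, comb a m * q = comb b m} := by
  have hf : ∀ q, q ∈ sphere3 → ((pencilMul a b 3 0 q * pencilMul a b 1 2 q).re
      - (pencilMul a b 1 0 q * pencilMul a b 3 2 q).re = 0 ↔
        ∃ m ≠ 0, comb a m * q = comb b m) := fun q hq => by
    rw [mem_sphere3_iff] at hq
    simp only [pencilMul_eq _ _ _ _ hq, ← Quaternion.re_sub]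
    rw [re_mul_eq_zero_iff fun i => a i * q - b i]
    simp only [comb_pencil, sub_eq_zero]
  refine ⟨fun q => (pencilMul a b 3 0 q * pencilMul a b 1 2 q).re
    - (pencilMul a b 1 0 q * pencilMul a b 3 2 q).re,
    ((isAffineMap_pencilMul _ _ _ _).re_mul (isAffineMap_pencilMul _ _ _ _)).sub
      ((isAffineMap_pencilMul _ _ _ _).re_mul (isAffineMap_pencilMul _ _ _ _)), ?_,
    fun q hq => (hf q hq.1).2 hq.2⟩
  by_contra! hall
  -- If `a(m) = 0` on the Segre quadric, then `b(m) = 0` too, so `m` is in the kernel of the polar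
  -- form of `m₀m₃ - m₁m₂`, which is nondegenerate.
  have hA : ∀ α β, comb a (segre α β) ≠ 0 := fun α β h0 => by
    have hN := h (segre α β)
    have hseg : segre α β 0 * segre α β 3 - segre α β 1 * segre α β 2 = 0 := by
      simp [segre]
      ring
    rw [hseg, mul_zero, h0, map_zero, zero_sub, neg_eq_zero, Quaternion.normSq_eq_zero] at hN
    have hp : ∀ m : Fin 4 → ℝ, m 0 * segre α β 3 + m 3 * segre α β 0 - m 1 * segre α β 2
        - m 2 * segre α β 1 = 0 := fun m => by
      have h1 := h (m + segre α β)
      rw [(comb a).map_add, (comb b).map_add, h0, hN, add_zero, add_zero, h] at h1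
      have h2 := mul_left_cancel₀ hlam h1
      simp only [Pi.add_apply] at h2
      linear_combination -hseg - h2
    refine segre_ne_zero α β (funext fun i => ?_)
    fin_cases i
    · simpa using hp ![0, 0, 0, 1]
    · simpa using hp ![0, 0, 1, 0]
    · simpa using hp ![0, 1, 0, 0]
    · simpa using hp ![1, 0, 0, 0]
  refine not_surjective_of_contDiff (G := fun p => p.1 •
    ((comb a (segre p.2.1 p.2.2))⁻¹ * comb b (segre p.2.1 p.2.2))) ?_ fun y => ?_
  · simp only [inv_mul_eq_smul]
    have ha := contDiff_comb_segre a
    have hb := contDiff_comb_segre b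
    refine contDiff_fst.smul (((ha.norm_sq ℝ).inv fun p => ?_).smul
      ((contDiff_star.comp ha).mul hb))
    exact pow_ne_zero 2 (norm_ne_zero_iff.2 (hA _ _))
  · rcases eq_or_ne y 0 with rfl | hy
    · exact ⟨0, by simp⟩
    · have hy' : ‖y‖ ≠ 0 := norm_ne_zero_iff.2 hy
      have hq : ‖y‖⁻¹ • y ∈ sphere3 := by
        change ‖‖y‖⁻¹ • y‖ = 1
        rw [norm_smul, norm_inv, norm_norm, inv_mul_cancel₀ hy']
      obtain ⟨m, hm, hmq⟩ := (hf _ hq).1 (hall _ hq)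
      have hN := h m
      rw [← hmq, map_mul, mem_sphere3_iff.1 hq, mul_one, sub_self] at hN
      obtain ⟨r, α, β, rfl⟩ := exists_segre
        (sub_eq_zero.1 ((mul_eq_zero.1 hN.symm).resolve_left hlam))
      have hr : r ≠ 0 := by
        rintro rfl
        simp at hm
      refine ⟨(‖y‖, α, β), ?_⟩
      rw [map_smul, map_smul, smul_mul_assoc] at hmq
      have := smul_right_injective _ hr hmq
      simp only at this ⊢
      rw [← this, inv_mul_cancel_left₀ (hA α β), smul_smul, mul_inv_cancel₀ hy', one_smul]

/-! ### One-sided fractions in `S³`: conclusion. -/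

theorem InQuadric.mono {V W : Set HH} (hW : InQuadric W) (h : V ⊆ W) : InQuadric V := by
  obtain ⟨f, hf, hne, hz⟩ := hW
  exact ⟨f, hf, hne, fun x hx => hz x (h hx)⟩

/-- The surfaces `A⁻¹ B` in `S³` with bilinear `A` and `B` lie on a quadric. -/
theorem inQuadric_of_mul_eq {a b : Fin 4 → HH} {U : Set (ℝ × ℝ)} (hU : IsOpen U)
    (hne : U.Nonempty) {Φ : ℝ × ℝ → HH} (hA : ∀ p ∈ U, comb a (monomials p) ≠ 0)
    (h : ∀ p ∈ U, comb a (monomials p) * Φ p = comb b (monomials p))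
    (hS : Φ '' U ⊆ sphere3) : InQuadric (Φ '' U) := by
  obtain ⟨lam, hlam⟩ := normSq_comb_sub_eq (a := a) (b := b) hU hne fun p hp => by
    rw [← h p hp, map_mul, mem_sphere3_iff.1 (hS ⟨p, hp, rfl⟩), mul_one]
  by_cases h0 : lam = 0
  · obtain ⟨T, hT⟩ := exists_isometry (comb a) (comb b) fun m => by
      have := hlam m
      rw [h0, zero_mul, sub_eq_zero, Quaternion.normSq_eq_norm_mul_self,
        Quaternion.normSq_eq_norm_mul_self] at this
      exact (mul_self_inj (norm_nonneg _) (norm_nonneg _)).1 this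
    have hrange : Φ '' U = Set.range fun p : U => Φ p := by
      ext x
      simp
    rw [hrange]
    obtain ⟨p, q, hp, hq, hpq | hpq⟩ := isUnitMul_of_isometry T
    · exact inQuadric_conjugation (A := fun i : U => comb a (monomials i)) hq
        (fun i => hA i i.2) fun i => by rw [h i i.2, ← hT, hpq]
    · exact inQuadric_anticonjugation (P := fun i : U => (i : ℝ × ℝ)) hp hq
        (fun i => hA i i.2) fun i => by rw [h i i.2, ← hT, hpq]
  · refine (inQuadric_of_nondegenerate h0 hlam).mono ?_
    rintro _ ⟨p, hp, rfl⟩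
    refine ⟨hS ⟨p, hp, rfl⟩, monomials p, fun h1 => ?_, h p hp⟩
    simpa [monomials] using congrFun h1 0

/-- The surfaces `B C⁻¹` in `S³` with bilinear `B` and `C` lie on a quadric. -/
theorem inQuadric_of_mul_eq' {b c : Fin 4 → HH} {U : Set (ℝ × ℝ)} (hU : IsOpen U)
    (hne : U.Nonempty) {Φ : ℝ × ℝ → HH} (hC : ∀ p ∈ U, comb c (monomials p) ≠ 0)
    (h : ∀ p ∈ U, Φ p * comb c (monomials p) = comb b (monomials p))
    (hS : Φ '' U ⊆ sphere3) : InQuadric (Φ '' U) := by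
  have hstar : ∀ (x : Fin 4 → HH) m, comb (fun i => star (x i)) m = star (comb x m) := fun x m => by
    simp only [comb_apply, star_add, Quaternion.star_smul]
  refine InQuadric.of_star ?_
  rw [Set.image_image]
  refine inQuadric_of_mul_eq (a := fun i => star (c i)) (b := fun i => star (b i)) hU hne
    (fun p hp => ?_) (fun p hp => ?_) ?_
  · rw [hstar, star_ne_zero]
    exact hC p hp
  · rw [hstar, hstar, ← star_mul, h p hp]
  · rintro _ ⟨p, hp, rfl⟩
    rw [mem_sphere3_iff, Quaternion.normSq_star, ← mem_sphere3_iff]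
    exact hS ⟨p, hp, rfl⟩

/-! ### The Cayley transform and one-sided fractions in `ℝ³`. -/

theorem mem_imH_iff {q : HH} : q ∈ imH ↔ q.re = 0 := Iff.rfl

theorem one_add_ne_zero_of_mem_imH {x : HH} (hx : x ∈ imH) : 1 + x ≠ 0 := fun h => by
  have := congrArg (fun q : HH => q.re) h
  simp [mem_imH_iff.1 hx] at this

/-- The Cayley transform of an imaginary quaternion in coordinates. -/
theorem cayley_eq {x : HH} (hx : x ∈ imH) : (1 + x)⁻¹ * (1 - x) =
    (1 + Quaternion.normSq x)⁻¹ • ((1 - Quaternion.normSq x : ℝ) - (2 : ℝ) • x) := by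
  have hre := mem_imH_iff.1 hx
  have h0 : 1 + Quaternion.normSq x ≠ 0 := by
    have := Quaternion.normSq_nonneg (a := x)
    positivity
  refine mul_left_cancel₀ (one_add_ne_zero_of_mem_imH hx) ?_
  rw [mul_inv_cancel_left₀ (one_add_ne_zero_of_mem_imH hx), mul_smul_comm,
    eq_inv_smul_iff₀ h0]
  have hn := Quaternion.normSq_def' (a := x)
  rw [hre] at hn
  generalize Quaternion.normSq x = N at *
  ext <;> simp [hre] <;> subst hn <;> ring

theorem cayley_mem_sphere3 {x : HH} (hx : x ∈ imH) : (1 + x)⁻¹ * (1 - x) ∈ sphere3 := by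
  rw [mem_sphere3_iff, map_mul, Quaternion.normSq_inv]
  have e : Quaternion.normSq (1 - x) = Quaternion.normSq (1 + x) := by
    simp only [Quaternion.normSq_def']
    simp [mem_imH_iff.1 hx]
  rw [e, inv_mul_cancel₀]
  exact Quaternion.normSq_ne_zero.2 (one_add_ne_zero_of_mem_imH hx)

/-- The Cayley transform is inverted by the same formula, `x = (1 - q)(1 + q)⁻¹`. -/
theorem exists_cayley_eq {q : HH} (hq : q ∈ sphere3) (h1 : q.re ≠ -1) :
    ∃ x ∈ imH, (1 + x)⁻¹ * (1 - x) = q := by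
  have h0 : 1 + q ≠ 0 := fun h => by
    have := congrArg (fun q : HH => q.re) h
    simp at this
    exact h1 (by linarith)
  have hx : (1 - q) * (1 + q)⁻¹ ∈ imH := by
    rw [mem_sphere3_iff, Quaternion.normSq_def'] at hq
    rw [mem_imH_iff, Quaternion.inv_def, mul_smul_comm, Quaternion.re_smul]
    simp
    right
    linarith
  refine ⟨_, hx, ?_⟩
  rw [inv_mul_eq_iff_eq_mul₀ (one_add_ne_zero_of_mem_imH hx)]
  refine mul_right_cancel₀ h0 ?_
  have e2 : q * (1 + q) = (1 + q) * q := by noncomm_ring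
  rw [sub_mul, inv_mul_cancel_right₀ h0, mul_assoc _ q, e2, ← mul_assoc, add_mul,
    inv_mul_cancel_right₀ h0]
  noncomm_ring

/-- The Cayley transform misses only the point `-1` of `S³`, which is reached by continuity along
the great circle `cos t + i sin t` as `t → π`. -/
theorem IsQuadFun.eq_zero_of_cayley {f : HH → ℝ} (hf : IsQuadFun f)
    (h : ∀ x ∈ imH, f ((1 + x)⁻¹ * (1 - x)) = 0) {q : HH} (hq : q ∈ sphere3) : f q = 0 := by
  have h1 : ∀ q ∈ sphere3, q.re ≠ -1 → f q = 0 := fun q hq hre => by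
    obtain ⟨x, hx, rfl⟩ := exists_cayley_eq hq hre
    exact h x hx
  by_cases hre : q.re = -1
  · obtain ⟨i, hi⟩ : ∃ i : HH, i = ⟨0, 1, 0, 0⟩ := ⟨_, rfl⟩
    have hq1 : q = -1 := by
      rw [mem_sphere3_iff, Quaternion.normSq_def', hre] at hq
      have e1 : q.imI = 0 := by nlinarith [sq_nonneg q.imI, sq_nonneg q.imJ, sq_nonneg q.imK]
      have e2 : q.imJ = 0 := by nlinarith [sq_nonneg q.imI, sq_nonneg q.imJ, sq_nonneg q.imK]
      have e3 : q.imK = 0 := by nlinarith [sq_nonneg q.imI, sq_nonneg q.imJ, sq_nonneg q.imK]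
      ext <;> simp [*]
    let g : ℝ → HH := fun t => (Real.cos t : HH) + Real.sin t • i
    have hg : Continuous g := by
      have := Quaternion.continuous_coe
      fun_prop
    have hz : Set.Ioo 0 Real.pi ⊆ {t | f (g t) = 0} := fun t ht => by
      have hs := Real.sin_pos_of_pos_of_lt_pi ht.1 ht.2
      have hsc := Real.sin_sq_add_cos_sq t
      refine h1 _ ?_ ?_
      · rw [mem_sphere3_iff, Quaternion.normSq_def']
        simp [g]
        simp [hi]
      · simp [g]
        simp [hi]
        intro hc
        rw [hc] at hsc
        nlinarith
    have hcl := closure_minimal hz (isClosed_eq (hf.continuous.comp hg) continuous_const)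
    rw [closure_Ioo Real.pi_pos.ne] at hcl
    have := hcl (Set.right_mem_Icc.2 Real.pi_pos.le)
    simpa [g, hq1] using this
  · exact h1 q hq hre

theorem IsQuadFun.exists_cyclide {f : HH → ℝ} (hf : IsQuadFun f) (hne : ∃ q ∈ sphere3, f q ≠ 0) :
    ∃ S, IsDarbouxCyclide S ∧ ∀ x ∈ imH, f ((1 + x)⁻¹ * (1 - x)) = 0 → x ∈ S := by
  obtain ⟨c, l, k, h⟩ := id hf
  -- With `N = |x|²` the Cayley transform is `((1 - N) - 2x) / (1 + N)`. The coefficients of `g`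
  -- come from expanding `(1 + N)² f` and sorting by powers of `N`; the terms `(2c - 2k₀₀)N` go into
  -- the quadratic part.
  let l' : Fin 3 → ℝ := fun i => -2 * l i.succ - 2 * (k 0 i.succ + k i.succ 0)
  let k' : Fin 3 → Fin 3 → ℝ := fun i j =>
    4 * k i.succ j.succ + if i = j then 2 * c - 2 * k 0 0 else 0
  let β : Fin 3 → ℝ := fun i => -2 * l i.succ + 2 * (k 0 i.succ + k i.succ 0)
  let g : HH → ℝ := fun q => (c - l 0 + k 0 0) * (q.imI ^ 2 + q.imJ ^ 2 + q.imK ^ 2) ^ 2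
        + (q.imI ^ 2 + q.imJ ^ 2 + q.imK ^ 2) * (β 0 * q.imI + β 1 * q.imJ + β 2 * q.imK)
        + MvPolynomial.eval ![q.imI, q.imJ, q.imK] (quadPoly (c + l 0 + k 0 0) l' k')
  have hg : ∀ x ∈ imH, g x = (1 + Quaternion.normSq x) ^ 2 * f ((1 + x)⁻¹ * (1 - x)) :=
      fun x hx => by
    have h0 : 1 + Quaternion.normSq x ≠ 0 := by
      have := Quaternion.normSq_nonneg (a := x)
      positivity
    have hn : Quaternion.normSq x = x.imI ^ 2 + x.imJ ^ 2 + x.imK ^ 2 := by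
      rw [Quaternion.normSq_def', mem_imH_iff.1 hx]
      ring
    have hc : coords ((1 + x)⁻¹ * (1 - x)) =
        ![(1 + Quaternion.normSq x)⁻¹ * (1 - Quaternion.normSq x),
          (1 + Quaternion.normSq x)⁻¹ * (-2 * x.imI), (1 + Quaternion.normSq x)⁻¹ * (-2 * x.imJ),
          (1 + Quaternion.normSq x)⁻¹ * (-2 * x.imK)] := by
      rw [cayley_eq hx, coords]
      simp [mem_imH_iff.1 hx]
    have hs : (0 : Fin 3).succ = 1 ∧ (1 : Fin 3).succ = 2 ∧ (2 : Fin 3).succ = 3 := ⟨rfl, rfl, rfl⟩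
    have hd : (0 : Fin 3) ≠ 1 ∧ (0 : Fin 3) ≠ 2 ∧ (1 : Fin 3) ≠ 2 ∧ (1 : Fin 3) ≠ 0 ∧
      (2 : Fin 3) ≠ 0 ∧ (2 : Fin 3) ≠ 1 := by decide
    rw [h, hc]
    simp only [g, β, l', k', eval_quadPoly, Fin.sum_univ_four, Fin.sum_univ_three, hs, hd,
      Matrix.cons_val, if_true, if_false]
    rw [← hn]
    field_simp
    rw [hn]
    ring
  refine ⟨{q | q ∈ imH ∧ g q = 0}, ⟨c - l 0 + k 0 0, β 0, β 1, β 2, _,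
    totalDegree_quadPoly _ _ _, fun hall => ?_, rfl⟩, fun x hx hfx => ⟨hx, ?_⟩⟩
  · obtain ⟨ha, hb, hc, hd, hQ⟩ := hall
    obtain ⟨q, hq, hq0⟩ := hne
    refine hq0 (hf.eq_zero_of_cayley (fun x hx => ?_) hq)
    have h0 : 1 + Quaternion.normSq x ≠ 0 := by
      have := Quaternion.normSq_nonneg (a := x)
      positivity
    have := hg x hx
    simp only [g, ha, hb, hc, hd, hQ, map_zero] at this
    simpa [h0] using this
  · rw [hg x hx, hfx, mul_zero]

/-- The surfaces `A⁻¹ B` in `ℝ³` with bilinear `A` and `B` lie on Darboux cyclides. -/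
theorem exists_cyclide_of_mul_eq {a b : Fin 4 → HH} {U : Set (ℝ × ℝ)} (hU : IsOpen U)
    (hne : U.Nonempty) {Φ : ℝ × ℝ → HH} (hA : ∀ p ∈ U, comb a (monomials p) ≠ 0)
    (h : ∀ p ∈ U, comb a (monomials p) * Φ p = comb b (monomials p))
    (hS : Φ '' U ⊆ imH) : ∃ S, IsDarbouxCyclide S ∧ Φ '' U ⊆ S := by
  have hΦ : ∀ p ∈ U, Φ p ∈ imH := fun p hp => hS ⟨p, hp, rfl⟩
  have hadd : ∀ m, comb (fun i => a i + b i) m = comb a m + comb b m := fun m => by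
    simp only [comb_apply, smul_add]
    abel
  have hsub : ∀ m, comb (fun i => a i - b i) m = comb a m - comb b m := fun m => by
    simp only [comb_apply, smul_sub]
    abel
  have hsum : ∀ p ∈ U, comb a (monomials p) + comb b (monomials p) =
      comb a (monomials p) * (1 + Φ p) := fun p hp => by rw [← h p hp, mul_add, mul_one]
  obtain ⟨f, hf, hf0, hz⟩ : InQuadric ((fun p => (1 + Φ p)⁻¹ * (1 - Φ p)) '' U) := by
    -- The Cayley transform of `A⁻¹B` is `(A + B)⁻¹(A - B)`, again a one-sided bilinear fraction.
    refine inQuadric_of_mul_eq (a := fun i => a i + b i) (b := fun i => a i - b i) hU hne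
      (fun p hp => ?_) (fun p hp => ?_) ?_
    · rw [hadd, hsum p hp]
      exact mul_ne_zero (hA p hp) (one_add_ne_zero_of_mem_imH (hΦ p hp))
    · rw [hadd, hsum p hp, hsub, mul_assoc,
        mul_inv_cancel_left₀ (one_add_ne_zero_of_mem_imH (hΦ p hp)), mul_sub, mul_one, h p hp]
    · rintro _ ⟨p, hp, rfl⟩
      exact cayley_mem_sphere3 (hΦ p hp)
  obtain ⟨S, hS', hmem⟩ := hf.exists_cyclide hf0
  refine ⟨S, hS', ?_⟩
  rintro _ ⟨p, hp, rfl⟩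
  exact hmem _ (hΦ p hp) (hz _ ⟨p, hp, rfl⟩)

/-- The surfaces `B C⁻¹` in `ℝ³` with bilinear `B` and `C` lie on Darboux cyclides. -/
theorem exists_cyclide_of_mul_eq' {b c : Fin 4 → HH} {U : Set (ℝ × ℝ)} (hU : IsOpen U)
    (hne : U.Nonempty) {Φ : ℝ × ℝ → HH} (hC : ∀ p ∈ U, comb c (monomials p) ≠ 0)
    (h : ∀ p ∈ U, Φ p * comb c (monomials p) = comb b (monomials p))
    (hS : Φ '' U ⊆ imH) : ∃ S, IsDarbouxCyclide S ∧ Φ '' U ⊆ S := by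
  have hstar : ∀ (x : Fin 4 → HH) m, comb (fun i => star (x i)) m = star (comb x m) := fun x m => by
    simp only [comb_apply, star_add, Quaternion.star_smul]
  -- As `Φ` is imaginary, conjugating `ΦC = B` gives `C̄Φ = -B̄`.
  refine exists_cyclide_of_mul_eq (a := fun i => star (c i)) (b := fun i => -star (b i)) hU hne
    (fun p hp => ?_) (fun p hp => ?_) hS
  · rw [hstar, star_ne_zero]
    exact hC p hp
  · have hneg : comb (fun i => -star (b i)) (monomials p) = -comb (fun i => star (b i))
        (monomials p) := by
      simp only [comb_apply, smul_neg]
      abel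
    have hΦ : star (Φ p) = -Φ p := by
      have := mem_imH_iff.1 (hS ⟨p, hp, rfl⟩)
      ext <;> simp [this]
    rw [hneg, hstar, hstar, ← h p hp, star_mul, hΦ, mul_neg, neg_neg]

/-! ### Normal forms in `ℝ³`. -/

theorem mul_self_of_unit_imaginary {a : HH} (ha : a.re = 0) (ha1 : Quaternion.normSq a = 1) :
    a * a = -1 := by
  rw [Quaternion.normSq_def', ha] at ha1
  ext <;> simp [ha] <;> linarith

theorem star_of_re_eq_zero {a : HH} (ha : a.re = 0) : star a = -a := by
  ext <;> simp [ha]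

theorem mul_eq_neg_mul {x y : HH} (hx : x.re = 0) (hy : y.re = 0) (hxy : (x * y).re = 0) :
    x * y = -(y * x) := by
  have := star_of_re_eq_zero hxy
  rw [star_mul, star_of_re_eq_zero hx, star_of_re_eq_zero hy, neg_mul_neg] at this
  rw [this, neg_neg]

theorem coe_add_ne_zero {a : HH} (ha : a.re = 0) (ha1 : Quaternion.normSq a = 1) (u : ℝ) :
    (u : HH) + a ≠ 0 := fun h => by
  have h1 : (u : HH) = -a := eq_neg_of_add_eq_zero_left h
  have h2 : u = 0 := by simpa [ha] using congrArg (fun q : HH => q.re) h1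
  rw [h2, Quaternion.coe_zero, zero_eq_neg] at h1
  simp [h1] at ha1

theorem inv_coe_add {a : HH} (ha : a.re = 0) (ha1 : Quaternion.normSq a = 1) (u : ℝ) :
    ((u : HH) + a)⁻¹ = (u ^ 2 + 1)⁻¹ • ((u : HH) - a) := by
  have h0 : u ^ 2 + 1 ≠ 0 := by positivity
  have e : ((u : HH) + a) * ((u : HH) - a) = ((u * u + 1 : ℝ) : HH) := by
    rw [Quaternion.normSq_def', ha] at ha1
    ext <;> simp [ha]
    · linarith
    all_goals ring
  refine inv_eq_of_mul_eq_one_right ?_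
  rw [mul_smul_comm, e, ← sq, ← Quaternion.coe_mul_eq_smul, ← Quaternion.coe_mul, inv_mul_cancel₀ h0,
    Quaternion.coe_one]

theorem exists_angle {x y : ℝ} (h : x ^ 2 + y ^ 2 = 1) :
    ∃ t : ℝ, x = Real.cos t ∧ y = Real.sin t := by
  obtain ⟨r, t, hx, hy⟩ := exists_polar x y
  have hr : r ^ 2 = 1 := by
    rw [hx, hy] at h
    linear_combination h - r ^ 2 * Real.sin_sq_add_cos_sq t
  rcases sq_eq_one_iff.1 hr with rfl | rfl
  · exact ⟨t, by simpa using hx, by simpa using hy⟩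
  · exact ⟨t + Real.pi, by simpa using hx, by simpa using hy⟩

theorem isCircle_setOf {m x y : HH} (hx : x ≠ 0) (hxy : ‖x‖ = ‖y‖) (h : inner ℝ x y = 0) :
    IsCircle {p | ∃ t : ℝ, p = m + Real.cos t • x + Real.sin t • y} := by
  have hx' : ‖x‖ ≠ 0 := norm_ne_zero_iff.2 hx
  refine ⟨m, ‖x‖⁻¹ • x, ‖x‖⁻¹ • y, ‖x‖, norm_pos_iff.2 hx, ?_, ?_, ?_, ?_⟩
  · rw [norm_smul, norm_inv, norm_norm, inv_mul_cancel₀ hx']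
  · rw [norm_smul, norm_inv, norm_norm, ← hxy, inv_mul_cancel₀ hx']
  · rw [real_inner_smul_left, real_inner_smul_right, h, mul_zero, mul_zero]
  · ext p
    simp only [Set.mem_ofPred_eq, smul_smul]
    have e : ∀ c : ℝ, ‖x‖ * c * ‖x‖⁻¹ = c := fun c => by field_simp
    simp only [e]

theorem normSq_eq_norm_sq (x : HH) : Quaternion.normSq x = ‖x‖ ^ 2 := by
  rw [Quaternion.normSq_eq_norm_mul_self, sq]

theorem norm_mul_left_of_unit {a : HH} (ha1 : Quaternion.normSq a = 1) (d : HH) :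
    ‖a * d‖ = ‖d‖ := by
  rw [norm_mul, show ‖a‖ = 1 from mem_sphere3_iff.2 ha1, one_mul]

theorem norm_mul_right_of_unit {a : HH} (ha1 : Quaternion.normSq a = 1) (d : HH) :
    ‖d * a‖ = ‖d‖ := by
  rw [norm_mul, show ‖a‖ = 1 from mem_sphere3_iff.2 ha1, mul_one]

theorem inner_mul_left_self {a : HH} (ha : a.re = 0) (d : HH) : inner ℝ (a * d) d = 0 := by
  rw [Quaternion.inner_def, mul_assoc, Quaternion.self_mul_star, Quaternion.mul_coe_eq_smul]
  simp [ha]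

theorem inner_mul_right_self {a : HH} (ha : a.re = 0) (d : HH) : inner ℝ (d * a) d = 0 := by
  rw [Quaternion.inner_def, mul_assoc, re_mul_comm, mul_assoc, Quaternion.star_mul_self,
    Quaternion.mul_coe_eq_smul]
  simp [ha]

/-- The circle through the origin traced by the real multiples of `x` and `y` with coefficients
rational in a parameter. -/
theorem exists_angle_rational (u : ℝ) : ∃ t : ℝ, ∀ x y : HH,
    (u ^ 2 + 1)⁻¹ • (u • y - x) =
      -((1 / 2 : ℝ) • x) + Real.cos t • ((1 / 2 : ℝ) • x) + Real.sin t • ((1 / 2 : ℝ) • y) := by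
  have h0 : u ^ 2 + 1 ≠ 0 := by positivity
  -- The rational parametrization of the circle, with `u = cot(t/2)`.
  obtain ⟨t, hc, hs⟩ := exists_angle (x := (u ^ 2 - 1) / (u ^ 2 + 1))
    (y := 2 * u / (u ^ 2 + 1)) (by field_simp; ring)
  refine ⟨t, fun x y => ?_⟩
  rw [← hc, ← hs]
  match_scalars
  · field_simp
  · field_simp
    ring

/-- The real part is minus the inner product of `x - b` with `a`, so this is a plane with normal
`a`; planes count as cyclides with linear `Q`. -/
theorem exists_planar_cyclide {a b : HH} (ha : a.re = 0) (ha1 : Quaternion.normSq a = 1)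
    (hb : b.re = 0) : ∃ S, IsDarbouxCyclide S ∧ ∀ x ∈ imH, ((x - b) * a).re = 0 → x ∈ S := by
  let l : Fin 3 → ℝ := ![a.imI, a.imJ, a.imK]
  let c : ℝ := -(a.imI * b.imI + a.imJ * b.imJ + a.imK * b.imK)
  have hev : ∀ x, MvPolynomial.eval x (quadPoly c l 0) =
      c + (a.imI * x 0 + a.imJ * x 1 + a.imK * x 2) := fun x => by
    rw [eval_quadPoly]
    simp [l, Fin.sum_univ_three]
  refine ⟨_, ⟨0, 0, 0, 0, quadPoly c l 0, totalDegree_quadPoly _ _ _, ?_, rfl⟩, ?_⟩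
  · rintro ⟨-, -, -, -, hQ⟩
    have h0 := hev 0
    have h1 := hev l
    rw [hQ, map_zero] at h0 h1
    rw [Quaternion.normSq_def', ha] at ha1
    simp [l] at h0 h1
    linarith
  · intro x hx h
    refine ⟨hx, ?_⟩
    rw [hev]
    simp [mem_imH_iff.1 hx, hb] at h
    simp [c]
    linarith

/-- Surfaces `(u + a)⁻¹ B (v + c)⁻¹` in `ℝ³` with imaginary units `a` and `c`. -/
theorem exists_cyclide_or_translational {a c : HH} (ha : a.re = 0)
    (ha1 : Quaternion.normSq a = 1) (hc : c.re = 0) (hc1 : Quaternion.normSq c = 1)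
    {b : Fin 4 → HH} {U : Set (ℝ × ℝ)} (hU : IsOpen U) (hne : U.Nonempty) {Φ : ℝ × ℝ → HH}
    (h : ∀ p ∈ U, Φ p = ((p.1 : HH) + a)⁻¹ * comb b (monomials p) * ((p.2 : HH) + c)⁻¹)
    (hu : ¬ ∃ g : ℝ → HH, ∀ p ∈ U, Φ p = g p.1) (hv : ¬ ∃ g : ℝ → HH, ∀ p ∈ U, Φ p = g p.2)
    (hS : Φ '' U ⊆ imH) :
    ∃ S, (IsDarbouxCyclide S ∨ IsEuclideanTranslational S) ∧ Φ '' U ⊆ S := by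
  have haa := mul_self_of_unit_imaginary ha ha1
  have hcc := mul_self_of_unit_imaginary hc hc1
  have hre : ∀ p ∈ U,
      (((p.1 : HH) - a) * comb b (monomials p) * ((p.2 : HH) - c)).re = 0 := fun p hp => by
    have h1 := mem_imH_iff.1 (hS ⟨p, hp, rfl⟩)
    have h0 : ∀ u : ℝ, (u ^ 2 + 1)⁻¹ ≠ 0 := fun u => inv_ne_zero (by positivity)
    rw [h p hp, inv_coe_add ha ha1, inv_coe_add hc hc1, smul_mul_assoc, smul_mul_assoc,
      mul_smul_comm, Quaternion.re_smul, Quaternion.re_smul] at h1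
    simpa [h0] using h1
  obtain ⟨⟨h00, h10, h20⟩, ⟨h01, h11, h21⟩, ⟨h02, h12, h22⟩⟩ :=
    biquadratic_coeff_zero (c₀₀ := (a * b 0 * c).re) (c₁₀ := (a * b 1 * c - b 0 * c).re)
      (c₂₀ := -(b 1 * c).re) (c₀₁ := (a * b 2 * c - a * b 0).re)
      (c₁₁ := (b 0 - a * b 1 - b 2 * c + a * b 3 * c).re) (c₂₁ := (b 1 - b 3 * c).re)
      (c₀₂ := -(a * b 2).re) (c₁₂ := (b 2 - a * b 3).re) (c₂₂ := (b 3).re) hU hne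
      fun p hp => by
        refine Eq.trans ?_ (hre p hp)
        rw [comb_monomials]
        simp [ha, hc]
        ring
  -- Division with remainder: `B = (u + a) b₃ (v + c) + d₂(v + c) + (u + a)d₁ + δ`. The nine
  -- equations say that `d₁ ⊥ c`, `d₂ ⊥ a`, and that `b₃`, `d₁`, `d₂`, `δ`, `aδ`, `δc`, `aδc` are
  -- imaginary.
  obtain ⟨d₁, hd₁⟩ : ∃ d, d = b 1 - b 3 * c := ⟨_, rfl⟩
  obtain ⟨d₂, hd₂⟩ : ∃ d, d = b 2 - a * b 3 := ⟨_, rfl⟩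
  obtain ⟨δ, hδ⟩ : ∃ d, d = b 0 - a * b 1 - b 2 * c + a * b 3 * c := ⟨_, rfl⟩
  have hd₁re : d₁.re = 0 := by rw [hd₁, h21]
  have hd₂re : d₂.re = 0 := by rw [hd₂, h12]
  have hδre : δ.re = 0 := by rw [hδ, h11]
  have hd₁c : (d₁ * c).re = 0 := by
    have : d₁ * c = b 1 * c + b 3 := by
      rw [hd₁, sub_mul, mul_assoc, hcc]
      noncomm_ring
    rw [this, Quaternion.re_add, h22]
    linarith
  have had₂ : (a * d₂).re = 0 := by
    have : a * d₂ = a * b 2 + b 3 := by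
      rw [hd₂, mul_sub, ← mul_assoc, haa]
      noncomm_ring
    rw [this, Quaternion.re_add, h22]
    linarith
  have haδ : (a * δ).re = 0 := by
    have : a * δ = -(a * b 2 * c - a * b 0) + (b 1 - b 3 * c) := by
      have e : a * δ = a * b 0 - a * a * b 1 - a * b 2 * c + a * a * b 3 * c := by
        rw [hδ]
        noncomm_ring
      rw [e, haa]
      noncomm_ring
    rw [this, Quaternion.re_add, Quaternion.re_neg, h01, h21]
    simp
  have hδc : (δ * c).re = 0 := by
    have : δ * c = -(a * b 1 * c - b 0 * c) + (b 2 - a * b 3) := by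
      have e : δ * c = b 0 * c - a * b 1 * c - b 2 * (c * c) + a * b 3 * (c * c) := by
        rw [hδ]
        noncomm_ring
      rw [e, hcc]
      noncomm_ring
    rw [this, Quaternion.re_add, Quaternion.re_neg, h10, h12]
    simp
  have haδc : (a * δ * c).re = 0 := by
    have : a * δ * c = a * b 0 * c + b 1 * c + a * b 2 + b 3 := by
      have e : a * δ * c = a * b 0 * c - a * a * b 1 * c - a * b 2 * (c * c)
          + a * a * b 3 * (c * c) := by
        rw [hδ]
        noncomm_ring
      rw [e, hcc, haa]
      noncomm_ring
    rw [this, Quaternion.re_add, Quaternion.re_add, Quaternion.re_add, h00, h22]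
    linarith
  have ed₁ := mul_eq_neg_mul hd₁re hc hd₁c
  have ed₂ := mul_eq_neg_mul ha hd₂re had₂
  have eaδ := mul_eq_neg_mul ha hδre haδ
  have eδc := mul_eq_neg_mul hδre hc hδc
  have hB : ∀ p, comb b (monomials p) = ((p.1 : HH) + a) * b 3 * ((p.2 : HH) + c)
      + (d₂ * ((p.2 : HH) + c) + ((p.1 : HH) + a) * d₁ + δ) := fun p => by
    rw [comb_monomials, hd₁, hd₂, hδ]
    simp only [← Quaternion.coe_mul_eq_smul, Quaternion.coe_mul]
    have e1 : ∀ x : HH, x * (p.2 : HH) = (p.2 : HH) * x := fun x =>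
      (Quaternion.coe_commutes _ _).symm
    simp only [mul_add, add_mul, sub_mul, mul_sub, e1, mul_assoc]
    abel
  have hne1 := coe_add_ne_zero ha ha1
  have hne2 := coe_add_ne_zero hc hc1
  have hΦ : ∀ p ∈ U, Φ p = b 3 + ((p.1 : HH) + a)⁻¹ *
      (d₂ * ((p.2 : HH) + c) + ((p.1 : HH) + a) * d₁ + δ) * ((p.2 : HH) + c)⁻¹ := fun p hp => by
    rw [h p hp, hB, mul_add, add_mul, mul_assoc _ (b 3), inv_mul_cancel_left₀ (hne1 _),
      mul_inv_cancel_right₀ (hne2 _)]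
  -- If `a` and `c` commute, then `c = ±a`, and `d₁`, `d₂`, `δ` all anticommute with `a`. So does `Φ
  -- - b₃`, which therefore lies in the plane orthogonal to `a`.
  by_cases hac : a * c = c * a
  · have hca : c = a ∨ c = -a := by
      have : (c - a) * (c + a) = 0 := by
        rw [sub_mul, mul_add, mul_add, hac, hcc, haa]
        abel
      rcases mul_eq_zero.1 this with h1 | h1
      · exact Or.inl (sub_eq_zero.1 h1)
      · exact Or.inr (eq_neg_of_add_eq_zero_left h1)
    have ead₁ : a * d₁ = -(d₁ * a) := by
      rcases hca with rfl | rfl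
      · rw [ed₁, neg_neg]
      · simpa using ed₁.symm
    obtain ⟨S, hS', hmem⟩ := exists_planar_cyclide (b := b 3) ha ha1 h22
    refine ⟨S, Or.inl hS', ?_⟩
    rintro _ ⟨p, hp, rfl⟩
    refine hmem _ (hS ⟨p, hp, rfl⟩) ?_
    have c1 : Commute a ((p.1 : HH) + a) :=
      Commute.add_right (Quaternion.coe_commutes _ _).symm (Commute.refl a)
    have c2 : Commute a ((p.2 : HH) + c) :=
      Commute.add_right (Quaternion.coe_commutes _ _).symm hac
    have eX : ∀ x y : HH, Commute a x → Commute a y →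
        a * (d₂ * y + x * d₁ + δ) = -((d₂ * y + x * d₁ + δ) * a) := fun x y hx hy => by
      rw [mul_add, mul_add, add_mul, add_mul, ← mul_assoc, ed₂, ← mul_assoc a x, hx.eq,
        mul_assoc x a, ead₁, eaδ, mul_assoc _ _ a, ← hy.eq]
      noncomm_ring
    replace eX := eX _ _ c1 c2
    rw [hΦ p hp, add_sub_cancel_left]
    set X := d₂ * ((p.2 : HH) + c) + ((p.1 : HH) + a) * d₁ + δ
    have e1 : ((p.1 : HH) + a)⁻¹ * X * ((p.2 : HH) + c)⁻¹ * a
        = -(a * (((p.1 : HH) + a)⁻¹ * X * ((p.2 : HH) + c)⁻¹)) := by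
      rw [mul_assoc _ _ a, ← c2.inv_right₀.eq, ← mul_assoc, mul_assoc _ X a,
        ← neg_eq_iff_eq_neg.2 eX, ← mul_assoc, ← mul_assoc, c1.inv_right₀.eq]
      noncomm_ring
    have e2 := congrArg (fun q : HH => q.re) e1
    simp only [Quaternion.re_neg] at e2
    rw [re_mul_comm a] at e2
    linarith
  -- Geometrically `δ` is orthogonal to `a` and `c`, hence parallel to `a × c`, while `Re(aδc) = 0`
  -- is a vanishing triple product.
  · have hδ0 : δ = 0 := by
      have e := mul_eq_neg_mul (y := c) (x := a * δ) haδ hc haδc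
      have : δ * (a * c - c * a) = 0 := by
        have e1 : δ * (a * c - c * a) = (δ * a) * c - (δ * c) * a := by noncomm_ring
        have e2 : δ * a = -(a * δ) := by rw [eaδ, neg_neg]
        rw [e1, e2, eδc, neg_mul, neg_mul, mul_assoc c, e2, e]
        noncomm_ring
      exact (mul_eq_zero.1 this).resolve_right (sub_ne_zero.2 hac)
    have hΦ' : ∀ p ∈ U, Φ p = ((p.1 : HH) + a)⁻¹ * d₂ + (b 3 + d₁ * ((p.2 : HH) + c)⁻¹) :=
        fun p hp => by
      rw [hΦ p hp, hδ0, add_zero, mul_add, add_mul, inv_mul_cancel_left₀ (hne1 _), ← mul_assoc,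
        mul_inv_cancel_right₀ (hne2 _)]
      abel
    have hd₁0 : d₁ ≠ 0 := by
      rintro h0
      exact hu ⟨fun u => ((u : HH) + a)⁻¹ * d₂ + b 3, fun p hp => by simp [hΦ' p hp, h0]⟩
    have hd₂0 : d₂ ≠ 0 := by
      rintro h0
      exact hv ⟨fun v => b 3 + d₁ * ((v : HH) + c)⁻¹, fun p hp => by simp [hΦ' p hp, h0]⟩
    have ha0 : a ≠ 0 := by
      rintro rfl
      simp at ha1
    have hc0 : c ≠ 0 := by
      rintro rfl
      simp at hc1
    have h2 : (1 / 2 : ℝ) ≠ 0 := by norm_num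
    refine ⟨_, Or.inr ⟨_, _, isCircle_setOf (m := -((1 / 2 : ℝ) • (a * d₂)))
      (x := (1 / 2 : ℝ) • (a * d₂)) (y := (1 / 2 : ℝ) • d₂) ?_ ?_ ?_,
      isCircle_setOf (m := b 3 + -((1 / 2 : ℝ) • (d₁ * c)))
      (x := (1 / 2 : ℝ) • (d₁ * c)) (y := (1 / 2 : ℝ) • d₁) ?_ ?_ ?_, ?_, ?_, ?_, rfl⟩, ?_⟩
    · exact smul_ne_zero h2 (mul_ne_zero ha0 hd₂0)
    · rw [norm_smul, norm_smul, norm_mul_left_of_unit ha1]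
    · rw [real_inner_smul_left, real_inner_smul_right, inner_mul_left_self ha, mul_zero, mul_zero]
    · exact smul_ne_zero h2 (mul_ne_zero hd₁0 hc0)
    · rw [norm_smul, norm_smul, norm_mul_right_of_unit hc1]
    · rw [real_inner_smul_left, real_inner_smul_right, inner_mul_right_self hc, mul_zero, mul_zero]
    · rintro _ ⟨t, rfl⟩
      rw [mem_imH_iff]
      simp only [Quaternion.re_add, Quaternion.re_neg, Quaternion.re_smul, had₂, hd₂re]
      simp
    · rintro _ ⟨t, rfl⟩
      rw [mem_imH_iff]
      simp only [Quaternion.re_add, Quaternion.re_neg, Quaternion.re_smul, hd₁c, hd₁re, h22]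
      simp
    -- The first circle lies in a plane orthogonal to `a`. If the second were parallel to it, `d₁`
    -- and `d₁c` would anticommute with `a`, which forces `d₁(ac - ca) = 0`.
    · intro hspan
      have hperp : vectorSpan ℝ {p | ∃ t : ℝ, p = -((1 / 2 : ℝ) • (a * d₂))
          + Real.cos t • ((1 / 2 : ℝ) • (a * d₂)) + Real.sin t • ((1 / 2 : ℝ) • d₂)}
          ≤ (Submodule.span ℝ {a})ᗮ := by
        refine Submodule.span_le.2 ?_
        rintro _ ⟨_, ⟨t, rfl⟩, _, ⟨s, rfl⟩, rfl⟩
        have i1 : inner ℝ a (a * d₂) = 0 := by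
          rw [Quaternion.inner_def, star_mul, ← mul_assoc, re_mul_comm, ← mul_assoc,
            Quaternion.star_mul_self, star_of_re_eq_zero hd₂re, Quaternion.coe_mul_eq_smul]
          simp [hd₂re]
        have i2 : inner ℝ a d₂ = 0 := by
          rw [Quaternion.inner_def, star_of_re_eq_zero hd₂re, mul_neg, Quaternion.re_neg, had₂,
            neg_zero]
        rw [SetLike.mem_coe, Submodule.mem_orthogonal_singleton_iff_inner_right]
        simp only [vsub_eq_sub, inner_sub_right, inner_add_right, inner_neg_right,
          real_inner_smul_right, i1, i2]
        ring
      rw [hspan] at hperp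
      have hmem : ∀ t s : ℝ, inner ℝ a ((b 3 + -((1 / 2 : ℝ) • (d₁ * c))
          + Real.cos t • ((1 / 2 : ℝ) • (d₁ * c)) + Real.sin t • ((1 / 2 : ℝ) • d₁))
          - (b 3 + -((1 / 2 : ℝ) • (d₁ * c))
          + Real.cos s • ((1 / 2 : ℝ) • (d₁ * c)) + Real.sin s • ((1 / 2 : ℝ) • d₁))) = 0 :=
        fun t s => Submodule.mem_orthogonal_singleton_iff_inner_right.1
          (hperp (vsub_mem_vectorSpan ℝ ⟨t, rfl⟩ ⟨s, rfl⟩))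
      -- Opposite points of the second circle differ by `d₁c` and by `d₁`.
      have m1 := hmem 0 Real.pi
      have m2 := hmem (Real.pi / 2) (-(Real.pi / 2))
      simp only [inner_sub_right, inner_add_right, inner_neg_right, real_inner_smul_right,
        Real.cos_zero, Real.cos_pi, Real.sin_zero, Real.sin_pi, Real.cos_pi_div_two,
        Real.sin_pi_div_two, Real.cos_neg, Real.sin_neg, Quaternion.inner_def,
        star_of_re_eq_zero hd₁c, star_of_re_eq_zero hd₁re, mul_neg, Quaternion.re_neg] at m1 m2
      have n1 : (a * (d₁ * c)).re = 0 := by linarith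
      have n2 : (a * d₁).re = 0 := by linarith
      have f1 := mul_eq_neg_mul ha hd₁c n1
      have f2 := mul_eq_neg_mul ha hd₁re n2
      have : d₁ * (a * c - c * a) = 0 := by
        have e1 : d₁ * (a * c - c * a) = (d₁ * a) * c - d₁ * c * a := by noncomm_ring
        have e2 : d₁ * a = -(a * d₁) := by rw [f2, neg_neg]
        rw [e1, e2, neg_mul, mul_assoc a, f1]
        noncomm_ring
      exact (mul_ne_zero hd₁0 (sub_ne_zero.2 hac)) this
    · rintro _ ⟨p, hp, rfl⟩
      obtain ⟨t, ht⟩ := exists_angle_rational p.1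
      obtain ⟨s, hs⟩ := exists_angle_rational p.2
      refine ⟨_, ⟨t, rfl⟩, _, ⟨s, rfl⟩, ?_⟩
      rw [hΦ' p hp, inv_coe_add ha ha1, inv_coe_add hc hc1, smul_mul_assoc, mul_smul_comm,
        sub_mul, mul_sub, Quaternion.coe_mul_eq_smul, Quaternion.mul_coe_eq_smul, ht, hs]
      abel

/-! ### Normal forms in `S³`. -/

/-- The circle group of the imaginary unit `a`. -/
def unitExp (a : HH) (t : ℝ) : HH := (Real.cos t : HH) + Real.sin t • a

theorem normSq_unitExp {a : HH} (ha : a.re = 0) (ha1 : Quaternion.normSq a = 1) (t : ℝ) :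
    Quaternion.normSq (unitExp a t) = 1 := by
  rw [Quaternion.normSq_def'] at ha1 ⊢
  simp only [unitExp, Quaternion.re_add, Quaternion.imI_add, Quaternion.imJ_add,
    Quaternion.imK_add, Quaternion.re_coe, Quaternion.imI_coe, Quaternion.imJ_coe,
    Quaternion.imK_coe, Quaternion.re_smul, Quaternion.imI_smul, Quaternion.imJ_smul,
    Quaternion.imK_smul, smul_eq_mul, ha] at ha1 ⊢
  linear_combination Real.sin_sq_add_cos_sq t + Real.sin t ^ 2 * ha1

/-- The polar coordinates are those of `(u, 1)`, the same for all `a`; hence the moduli cancel in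
quotients such as `(u + a)⁻¹(u + b)`. -/
theorem exists_unitExp (u : ℝ) : ∃ r t : ℝ, r ≠ 0 ∧ ∀ a : HH, (u : HH) + a = r • unitExp a t := by
  obtain ⟨r, t, hx, hy⟩ := exists_polar u 1
  refine ⟨r, t, ?_, fun a => ?_⟩
  · rintro rfl
    simp at hy
  · rw [unitExp, smul_add, smul_smul, ← hy, one_smul, hx, Quaternion.coe_mul,
      Quaternion.coe_mul_eq_smul]

theorem inv_unitExp {a : HH} (ha : a.re = 0) (ha1 : Quaternion.normSq a = 1) (t : ℝ) :
    (unitExp a t)⁻¹ = unitExp (-a) t := by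
  rw [Quaternion.inv_def, normSq_unitExp ha ha1, inv_one, one_smul, unitExp, unitExp, star_add,
    Quaternion.star_coe, Quaternion.star_smul, star_of_re_eq_zero ha]

/-- With `x = (k - akb)/2` the product is `(k + akb)/2 + cos(2t) x + sin(2t) xb`, where `xb = (kb +
ak)/2` is orthogonal to `x` and of the same length. The hypothesis `hk` keeps the radius positive.
-/
theorem isCircle_unitExp {a b k : HH}
    (hb : b.re = 0) (hb1 : Quaternion.normSq b = 1) (hk : k * b + a * k ≠ 0) :
    IsCircle {p | ∃ t : ℝ, p = unitExp a t * k * unitExp b t} := by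
  have hbb := mul_self_of_unit_imaginary hb hb1
  set x : HH := (1 / 2 : ℝ) • (k - a * k * b) with hx
  have hxb : (1 / 2 : ℝ) • (k * b + a * k) = x * b := by
    rw [hx, smul_mul_assoc, sub_mul, mul_assoc _ b b, hbb]
    congr 1
    noncomm_ring
  have hx0 : x ≠ 0 := by
    rintro h0
    rw [h0, zero_mul] at hxb
    exact (smul_ne_zero (by norm_num) hk) hxb
  have key := isCircle_setOf (m := (1 / 2 : ℝ) • (k + a * k * b)) (y := x * b) hx0
    (norm_mul_right_of_unit hb1 x).symm (by rw [real_inner_comm, inner_mul_right_self hb])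
  have expand : ∀ t : ℝ, unitExp a t * k * unitExp b t = (1 / 2 : ℝ) • (k + a * k * b)
      + Real.cos (2 * t) • x + Real.sin (2 * t) • (x * b) := fun t => by
    have e : unitExp a t * k * unitExp b t = (Real.cos t ^ 2) • k
        + (Real.cos t * Real.sin t) • (k * b + a * k) + (Real.sin t ^ 2) • (a * k * b) := by
      simp only [unitExp, add_mul, mul_add, Quaternion.coe_mul_eq_smul, Quaternion.mul_coe_eq_smul,
        smul_mul_assoc, mul_smul_comm, smul_smul]
      module
    rw [e, ← hxb, hx, Real.cos_two_mul, Real.sin_two_mul, Real.sin_sq]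
    module
  convert key using 1
  ext p
  constructor
  · rintro ⟨t, rfl⟩
    exact ⟨2 * t, expand t⟩
  · rintro ⟨t, rfl⟩
    refine ⟨t / 2, ?_⟩
    rw [expand, mul_div_cancel₀ t two_ne_zero]

theorem unitExp_subset_sphere3 {a b k : HH} (ha : a.re = 0) (ha1 : Quaternion.normSq a = 1)
    (hb : b.re = 0) (hb1 : Quaternion.normSq b = 1) (hk : Quaternion.normSq k = 1) :
    {p | ∃ t : ℝ, p = unitExp a t * k * unitExp b t} ⊆ sphere3 := by
  rintro _ ⟨t, rfl⟩
  rw [mem_sphere3_iff, map_mul, map_mul, normSq_unitExp ha ha1, normSq_unitExp hb hb1, hk]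
  norm_num

theorem exists_not_commute {b : HH} (hb : b.re = 0) (hb1 : Quaternion.normSq b = 1) :
    ∃ x : HH, x * b - b * x ≠ 0 := by
  by_contra! h
  obtain ⟨i, hi⟩ : ∃ i : HH, i = ⟨0, 1, 0, 0⟩ := ⟨_, rfl⟩
  obtain ⟨j, hj⟩ : ∃ j : HH, j = ⟨0, 0, 1, 0⟩ := ⟨_, rfl⟩
  have h1 := Quaternion.ext_iff.1 (h i)
  have h2 := Quaternion.ext_iff.1 (h j)
  simp at h1 h2
  simp [hi, hj] at h1 h2
  rw [Quaternion.normSq_def', hb] at hb1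
  have e1 : b.imI = 0 := by linarith [h2.2]
  have e2 : b.imJ = 0 := by linarith [h1.2]
  have e3 : b.imK = 0 := by linarith [h1.1]
  rw [e1, e2, e3] at hb1
  norm_num at hb1

/-- Every `t - ctb` intertwines `b` and `c`. If all of them vanished, `t = 1` would give `c = -b`,
and then `b` would be central. -/
theorem exists_intertwiner {b c : HH} (hb : b.re = 0) (hb1 : Quaternion.normSq b = 1)
    (hc : c.re = 0) (hc1 : Quaternion.normSq c = 1) :
    ∃ N : HH, Quaternion.normSq N = 1 ∧ N * b = c * N := by
  have hbb := mul_self_of_unit_imaginary hb hb1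
  have hcc := mul_self_of_unit_imaginary hc hc1
  obtain ⟨M, hM0, hM⟩ : ∃ M : HH, M ≠ 0 ∧ M * b = c * M := by
    have hint : ∀ t : HH, (t - c * t * b) * b = c * (t - c * t * b) := fun t => by
      have e1 : (t - c * t * b) * b = t * b - c * t * (b * b) := by noncomm_ring
      have e2 : c * (t - c * t * b) = c * t - c * c * t * b := by noncomm_ring
      rw [e1, e2, hbb, hcc]
      noncomm_ring
    by_contra! h
    have hz : ∀ t : HH, t = c * t * b := fun t => by
      by_contra hne
      exact h _ (sub_ne_zero.2 hne) (hint t)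
    have hcb : c = -b := by
      have := congrArg (· * b) (hz 1)
      simp only [one_mul, mul_one, mul_assoc, hbb] at this
      rw [this]
      noncomm_ring
    obtain ⟨x, hx⟩ := exists_not_commute hb hb1
    refine hx (sub_eq_zero.2 ?_)
    have := congrArg (· * b) (hz x)
    simp only [mul_assoc, hbb, hcb] at this
    rw [this]
    noncomm_ring
  refine ⟨‖M‖⁻¹ • M, ?_, by rw [smul_mul_assoc, hM, mul_smul_comm]⟩
  have := norm_ne_zero_iff.2 hM0
  rw [Quaternion.normSq_smul, normSq_eq_norm_sq]
  field_simp

/-- If `Mb = cM`, cyclicity of the real part cancels `v + b` against `(v + c)⁻¹` in `Re((u + a)ΦM)`,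
leaving `Re((u + e)kM)`. The choices `M = N` and `M = cN` give two linear equations on `(u, 1)`;
their determinant vanishes and is quadratic in `Φ`. -/
theorem inQuadric_commutator {a b e c k : HH} (ha : a.re = 0) (ha1 : Quaternion.normSq a = 1)
    (hb : b.re = 0) (hb1 : Quaternion.normSq b = 1) (hc : c.re = 0)
    (hc1 : Quaternion.normSq c = 1) {U : Set (ℝ × ℝ)} {Φ : ℝ × ℝ → HH}
    (h : ∀ p ∈ U, Φ p = ((p.1 : HH) + a)⁻¹ *
      (((p.2 : HH) + b) * ((p.1 : HH) + e) * k) * ((p.2 : HH) + c)⁻¹) :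
    InQuadric (Φ '' U) := by
  have haa := mul_self_of_unit_imaginary ha ha1
  have hbb := mul_self_of_unit_imaginary hb hb1
  obtain ⟨N, hN1, hN⟩ := exists_intertwiner hb hb1 hc hc1
  have hNN : star N * N = 1 := star_mul_self_of_unit hN1
  have aff1 : ∀ M : HH, IsAffineMap fun q => (q - k) * M := fun M =>
    (IsAffineMap.id.sub (IsAffineMap.const _)).mul_const _
  have aff2 : ∀ M : HH, IsAffineMap fun q => (a * q - e * k) * M := fun M =>
    ((IsAffineMap.id.const_mul _).sub (IsAffineMap.const _)).mul_const _
  refine ⟨fun q => ((q - k) * N).re * ((a * q - e * k) * (c * N)).re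
    - ((q - k) * (c * N)).re * ((a * q - e * k) * N).re,
    ((aff1 _).re.mul (aff2 _).re).sub ((aff1 _).re.mul (aff2 _).re), ?_, ?_⟩
  · by_contra! hall
    -- Assuming that the determinant vanishes on `S³`, its even part under `q ↦ -q` vanishes there
    -- too; `K` is the constant term. In terms of `y = qN` a contradiction arises from three values
    -- of `y`: a commutator with `b` gives `K = 0`, `y = 1` gives `Re(ab) = 0`, and `y = 1 + ab`
    -- gives `1 = 0`.
    obtain ⟨K, hK⟩ : ∃ K, K = (k * N).re * (e * k * (c * N)).re
      - (k * (c * N)).re * (e * k * N).re := ⟨_, rfl⟩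
    have heven : ∀ q : HH, Quaternion.normSq q = 1 →
        (q * N).re * (a * q * (c * N)).re - (q * (c * N)).re * (a * q * N).re + K = 0 :=
      fun q hq => by
      have h1 := hall q (mem_sphere3_iff.2 hq)
      have h2 := hall (-q) (mem_sphere3_iff.2 (by rwa [Quaternion.normSq_neg]))
      simp only [sub_mul, Quaternion.re_sub, mul_neg, neg_mul, Quaternion.re_neg] at h1 h2
      linear_combination (h1 + h2) / 2 + hK
    have hy : ∀ y : HH, y.re * (a * y * b).re - (y * b).re * (a * y).re
        + K * Quaternion.normSq y = 0 := fun y => by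
      rcases eq_or_ne y 0 with rfl | hy0
      · simp
      · have hn : ‖y‖ ≠ 0 := norm_ne_zero_iff.2 hy0
        have h1 := heven (‖y‖⁻¹ • (y * star N)) (by
          rw [Quaternion.normSq_smul, map_mul, Quaternion.normSq_star, hN1, normSq_eq_norm_sq]
          field_simp)
        have e1 : y * star N * N = y := by rw [mul_assoc, hNN, mul_one]
        have e2 : y * star N * (c * N) = y * b := by
          rw [← hN, ← mul_assoc, e1]
        simp only [smul_mul_assoc, mul_smul_comm, mul_assoc a, e1, e2, Quaternion.re_smul,
          smul_eq_mul] at h1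
        rw [normSq_eq_norm_sq, mul_assoc a]
        field_simp at h1
        linear_combination h1
    have hK0 : K = 0 := by
      obtain ⟨x, hx⟩ := exists_not_commute hb hb1
      have h1 := hy (x * b - b * x)
      have e1 : (x * b - b * x).re = 0 := by
        rw [Quaternion.re_sub, re_mul_comm, sub_self]
      have e2 : ((x * b - b * x) * b).re = 0 := by
        have : ((b * x) * b).re = (x * b * b).re := by rw [mul_assoc, re_mul_comm]
        rw [sub_mul, Quaternion.re_sub, this, sub_self]
      rw [e1, e2, zero_mul, zero_mul, sub_zero, zero_add] at h1
      exact (mul_eq_zero.1 h1).resolve_right (Quaternion.normSq_ne_zero.2 hx)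
    have hab : (a * b).re = 0 := by
      have := hy 1
      simpa only [mul_one, one_mul, hb, zero_mul, sub_zero, hK0, Quaternion.re_one, add_zero]
        using this
    have h1 := hy (1 + a * b)
    have e1 : (a * (1 + a * b) * b).re = 1 := by
      have : a * (1 + a * b) * b = a * b + a * a * (b * b) := by noncomm_ring
      rw [this, haa, hbb]
      simp only [mul_neg, mul_one, neg_neg, Quaternion.re_add, hab, Quaternion.re_one,
        zero_add]
    have e2 : ((1 + a * b) * b).re = 0 := by
      have : (1 + a * b) * b = b + a * (b * b) := by noncomm_ring
      rw [this, hbb, mul_neg, mul_one, Quaternion.re_add, Quaternion.re_neg, ha, hb]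
      norm_num
    rw [e1, e2, hK0, Quaternion.re_add, hab, Quaternion.re_one] at h1
    norm_num at h1
  · rintro _ ⟨p, hp, rfl⟩
    have hne1 := coe_add_ne_zero ha ha1 p.1
    have hne2 := coe_add_ne_zero hc hc1 p.2
    have key : ∀ M : HH, M * b = c * M →
        p.1 * ((Φ p - k) * M).re + ((a * Φ p - e * k) * M).re = 0 := fun M hM => by
      have e1 : (((p.1 : HH) + a) * Φ p * M).re = (((p.1 : HH) + e) * k * M).re := by
        rw [h p hp, mul_assoc _ _ (((p.2 : HH) + c)⁻¹), mul_inv_cancel_left₀ hne1,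
          mul_assoc _ k, mul_assoc ((p.2 : HH) + b), mul_assoc ((p.2 : HH) + b), re_mul_comm]
        have hM' : M * ((p.2 : HH) + b) = ((p.2 : HH) + c) * M := by
          rw [mul_add, add_mul, hM, Quaternion.coe_commutes]
        rw [mul_assoc, hM', mul_assoc (_ + e), mul_assoc k, inv_mul_cancel_left₀ hne2,
          ← mul_assoc]
      have e2 : ((p.1 : HH) + a) * Φ p * M - ((p.1 : HH) + e) * k * M
          = p.1 • ((Φ p - k) * M) + (a * Φ p - e * k) * M := by
        rw [← Quaternion.coe_mul_eq_smul]
        noncomm_ring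
      have e3 := congrArg (fun q : HH => q.re) e2
      simp only [Quaternion.re_sub, Quaternion.re_add, Quaternion.re_smul, smul_eq_mul] at e3 e1 ⊢
      rw [← e3, e1, sub_self]
    have k1 := key N hN
    have k2 := key (c * N) (by rw [mul_assoc, hN])
    beta_reduce
    linear_combination ((Φ p - k) * N).re * k2 - ((Φ p - k) * (c * N)).re * k1

/-- Bilinear quaternionic polynomials of norm `(u² + 1)(v² + 1)` factor. -/
theorem eq_mul_or_eq_mul {b₁ b₂ w : HH} (h1 : b₁.re = 0) (h2 : b₂.re = 0)
    (h11 : Quaternion.normSq b₁ = 1) (h22 : Quaternion.normSq b₂ = 1)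
    (hw : Quaternion.normSq w = 1) (hre : w.re = (b₁ * b₂).re)
    (hw1 : (w * b₁).re = 0) (hw2 : (w * b₂).re = 0) : w = b₁ * b₂ ∨ w = b₂ * b₁ := by
  have hb1 := mul_self_of_unit_imaginary h1 h11
  have hb2 := mul_self_of_unit_imaginary h2 h22
  have hs : w + star w = b₁ * b₂ + b₂ * b₁ := by
    have h3 := hre
    simp [h1, h2] at h3
    ext <;> simp [h1, h2]
    · linarith
    all_goals ring
  have hsw : w + star w = ((2 * w.re : ℝ) : HH) := by
    ext <;> simp
    ring
  have comm : ∀ b : HH, b.re = 0 → (w * b).re = 0 → b * w = star w * b := fun b hb hwb => by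
    have := star_of_re_eq_zero hwb
    rw [star_mul, star_of_re_eq_zero hb] at this
    have h3 : (w + star w) * b = b * (w + star w) := by rw [hsw, Quaternion.coe_commutes]
    have h4 : b * star w = w * b := by
      rw [neg_mul] at this
      exact neg_injective this
    rw [add_mul, mul_add, h4] at h3
    exact (add_left_cancel (h3.trans (add_comm _ _))).symm
  have c1 := comm b₁ h1 hw1
  have c2 := comm b₂ h2 hw2
  have hcomm : b₁ * b₂ * w = w * (b₁ * b₂) := by
    have hb : b₁ * star w = w * b₁ := by
      have h3 : (w + star w) * b₁ = b₁ * (w + star w) := by rw [hsw, Quaternion.coe_commutes]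
      rw [add_mul, mul_add, c1, add_comm] at h3
      exact (add_left_cancel h3).symm
    rw [mul_assoc, c2, ← mul_assoc, hb, mul_assoc]
  -- Because `w` commutes with `b₁b₂` and `w + w̄ = b₁b₂ + b₂b₁`, the product expands to `w² - w(w +
  -- w̄) + 1 = 1 - |w|²`.
  have hprod : (w - b₁ * b₂) * (w - b₂ * b₁) = 0 := by
    have e1 : (w - b₁ * b₂) * (w - b₂ * b₁) =
        w * w - w * (b₂ * b₁) - b₁ * b₂ * w + b₁ * (b₂ * b₂) * b₁ := by noncomm_ring
    have e2 : w * w - w * (b₂ * b₁) - w * (b₁ * b₂) = - (w * star w) := by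
      have : w * w - w * (b₂ * b₁) - w * (b₁ * b₂) = w * w - w * (b₁ * b₂ + b₂ * b₁) := by
        noncomm_ring
      rw [this, ← hs]
      noncomm_ring
    rw [e1, hcomm, e2, mul_star_self_of_unit hw, hb2, mul_neg, mul_one, neg_mul, hb1]
    norm_num
  rcases mul_eq_zero.1 hprod with h | h
  · exact Or.inl (sub_eq_zero.1 h)
  · exact Or.inr (sub_eq_zero.1 h)

theorem inv_real_smul (r : ℝ) (x : HH) : (r • x)⁻¹ = r⁻¹ • x⁻¹ := by
  rw [← Quaternion.coe_mul_eq_smul, mul_inv_rev, ← Quaternion.coe_inv,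
    Quaternion.mul_coe_eq_smul]

/-- Surfaces `(u + a)⁻¹ B (v + c)⁻¹` in `S³` with imaginary units `a` and `c`. -/
theorem exists_section_or_translational {a c : HH} (ha : a.re = 0)
    (ha1 : Quaternion.normSq a = 1) (hc : c.re = 0) (hc1 : Quaternion.normSq c = 1)
    {b : Fin 4 → HH} {U : Set (ℝ × ℝ)} (hU : IsOpen U) (hne : U.Nonempty) {Φ : ℝ × ℝ → HH}
    (h : ∀ p ∈ U, Φ p = ((p.1 : HH) + a)⁻¹ * comb b (monomials p) * ((p.2 : HH) + c)⁻¹)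
    (hu : ¬ ∃ g : ℝ → HH, ∀ p ∈ U, Φ p = g p.1) (hv : ¬ ∃ g : ℝ → HH, ∀ p ∈ U, Φ p = g p.2)
    (hS : Φ '' U ⊆ sphere3) :
    ∃ S, (IsSphereQuadricSection S ∨ IsCliffordTranslational S) ∧ Φ '' U ⊆ S := by
  have hN : ∀ {a : HH}, a.re = 0 → Quaternion.normSq a = 1 → ∀ u : ℝ,
      Quaternion.normSq ((u : HH) + a) = u ^ 2 + 1 := fun {a} ha ha1 u => by
    rw [Quaternion.normSq_def'] at ha1 ⊢
    simp [ha] at ha1 ⊢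
    linarith
  have hne1 := coe_add_ne_zero ha ha1
  have hne2 := coe_add_ne_zero hc hc1
  have hB : ∀ p ∈ U, Quaternion.normSq (comb b (monomials p)) = (p.1 ^ 2 + 1) * (p.2 ^ 2 + 1) :=
      fun p hp => by
    have h1 := mem_sphere3_iff.1 (hS ⟨p, hp, rfl⟩)
    rw [h p hp, map_mul, map_mul, Quaternion.normSq_inv, Quaternion.normSq_inv, hN ha ha1,
      hN hc hc1] at h1
    have : p.1 ^ 2 + 1 ≠ 0 := by positivity
    have : p.2 ^ 2 + 1 ≠ 0 := by positivity
    field_simp at h1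
    linarith
  obtain ⟨⟨h00, h10, h20⟩, ⟨h01, h11, h21⟩, ⟨h02, h12, h22⟩⟩ :=
    biquadratic_coeff_zero (c₀₀ := Quaternion.normSq (b 0) - 1)
      (c₁₀ := 2 * (b 0 * star (b 1)).re) (c₂₀ := Quaternion.normSq (b 1) - 1)
      (c₀₁ := 2 * (b 0 * star (b 2)).re)
      (c₁₁ := 2 * (b 0 * star (b 3)).re + 2 * (b 1 * star (b 2)).re)
      (c₂₁ := 2 * (b 1 * star (b 3)).re) (c₀₂ := Quaternion.normSq (b 2) - 1)
      (c₁₂ := 2 * (b 2 * star (b 3)).re) (c₂₂ := Quaternion.normSq (b 3) - 1) hU hne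
      fun p hp => by
        refine Eq.trans ?_ (sub_eq_zero.2 (hB p hp))
        rw [comb_monomials]
        simp only [Quaternion.normSq_def']
        simp
        ring
  -- Splitting off the leading coefficient gives `B = (uv + u b₁ + v b₂ + w)k`. The nine equations
  -- from `|B|² = (u² + 1)(v² + 1)` make `b₁`, `b₂` imaginary units and supply the conditions on `w`
  -- needed to factor.
  obtain ⟨k, hk⟩ : ∃ k, k = b 3 := ⟨_, rfl⟩
  have hk1 : Quaternion.normSq k = 1 := by rw [hk]; linarith
  obtain ⟨b₁, hb₁⟩ : ∃ d, d = b 1 * star k := ⟨_, rfl⟩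
  obtain ⟨b₂, hb₂⟩ : ∃ d, d = b 2 * star k := ⟨_, rfl⟩
  obtain ⟨w, hw⟩ : ∃ d, d = b 0 * star k := ⟨_, rfl⟩
  have hre1 : b₁.re = 0 := by rw [hb₁, hk]; linarith
  have hre2 : b₂.re = 0 := by rw [hb₂, hk]; linarith
  have hn1 : Quaternion.normSq b₁ = 1 := by
    rw [hb₁, map_mul, Quaternion.normSq_star, hk1]; linarith
  have hn2 : Quaternion.normSq b₂ = 1 := by
    rw [hb₂, map_mul, Quaternion.normSq_star, hk1]; linarith
  have hnw : Quaternion.normSq w = 1 := by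
    rw [hw, map_mul, Quaternion.normSq_star, hk1]; linarith
  have hmul : ∀ x y : HH, x * star k * star (y * star k) = x * star y := fun x y => by
    rw [star_mul, star_star, mul_assoc, ← mul_assoc (star k), star_mul_self_of_unit hk1, one_mul]
  have hre : w.re = (b₁ * b₂).re := by
    have h3 : (b₁ * star b₂).re = -(b₁ * b₂).re := by
      rw [star_of_re_eq_zero hre2, mul_neg, Quaternion.re_neg]
    rw [hb₁, hb₂, hmul, ← hb₁, ← hb₂] at h3
    rw [hw, hk]
    linarith
  have hwb1 : (w * b₁).re = 0 := by
    have h3 : (w * star b₁).re = -(w * b₁).re := by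
      rw [star_of_re_eq_zero hre1, mul_neg, Quaternion.re_neg]
    rw [hb₁, hw, hmul, ← hb₁, ← hw] at h3
    linarith
  have hwb2 : (w * b₂).re = 0 := by
    have h3 : (w * star b₂).re = -(w * b₂).re := by
      rw [star_of_re_eq_zero hre2, mul_neg, Quaternion.re_neg]
    rw [hb₂, hw, hmul, ← hb₂, ← hw] at h3
    linarith
  have hback : ∀ x : HH, x * star k * k = x := fun x => by
    rw [mul_assoc, star_mul_self_of_unit hk1, mul_one]
  have hcomb : ∀ p, comb b (monomials p) =
      ((p.2 : HH) * (p.1 : HH) + (p.1 : HH) * b₁ + (p.2 : HH) * b₂ + w) * k := fun p => by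
    rw [comb_monomials, add_mul, add_mul, add_mul, mul_assoc _ b₁, mul_assoc _ b₂, hb₁, hb₂, hw,
      hback, hback, hback, ← hk]
    simp only [← Quaternion.coe_mul_eq_smul, Quaternion.coe_mul]
    rw [Quaternion.coe_commutes p.1 (p.2 : HH)]
    abel
  rcases eq_mul_or_eq_mul hre1 hre2 hn1 hn2 hnw hre hwb1 hwb2 with hw' | hw'
  · have hfac : ∀ p : ℝ × ℝ, (p.2 : HH) * (p.1 : HH) + (p.1 : HH) * b₁ + (p.2 : HH) * b₂ + w =
        ((p.2 : HH) + b₁) * ((p.1 : HH) + b₂) := fun p => by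
      rw [hw', add_mul, mul_add, mul_add, Quaternion.coe_commutes p.1 b₁]
      abel
    obtain ⟨S, hS', hsub⟩ := (inQuadric_commutator (k := k) (e := b₂) (U := U) (Φ := Φ) ha ha1
      hre1 hn1 hc hc1 fun p hp => by
        rw [h p hp, hcomb, hfac]).exists_section hS
    exact ⟨S, Or.inl hS', hsub⟩
  · have hfac : ∀ p : ℝ × ℝ, (p.2 : HH) * (p.1 : HH) + (p.1 : HH) * b₁ + (p.2 : HH) * b₂ + w =
        ((p.1 : HH) + b₂) * ((p.2 : HH) + b₁) := fun p => by
      rw [hw', add_mul, mul_add, mul_add, Quaternion.coe_commutes p.2 b₂,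
        Quaternion.coe_commutes p.2 (p.1 : HH)]
      abel
    have hΦ : ∀ p ∈ U, Φ p = (((p.1 : HH) + a)⁻¹ * ((p.1 : HH) + b₂)) *
        (((p.2 : HH) + b₁) * k * ((p.2 : HH) + c)⁻¹) := fun p hp => by
      rw [h p hp, hcomb, hfac]
      simp only [mul_assoc]
    -- If either circle shrank to a point, its factor would be constant and `Φ` would depend on a
    -- single parameter.
    have g1 : 1 * b₂ + -a * 1 ≠ 0 := fun h0 => by
      have : b₂ = a := by
        rw [one_mul, mul_one, ← sub_eq_add_neg] at h0
        exact sub_eq_zero.1 h0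
      exact hv ⟨fun v => ((v : HH) + b₁) * k * ((v : HH) + c)⁻¹, fun p hp => by
        rw [hΦ p hp, this, inv_mul_cancel₀ (hne1 _), one_mul]⟩
    have g2 : k * -c + b₁ * k ≠ 0 := fun h0 => by
      have : b₁ * k = k * c := by
        rw [mul_neg, neg_add_eq_sub] at h0
        exact sub_eq_zero.1 h0
      refine hu ⟨fun u => ((u : HH) + a)⁻¹ * ((u : HH) + b₂) * k, fun p hp => ?_⟩
      rw [hΦ p hp, add_mul, this, Quaternion.coe_commutes, ← mul_add,
        mul_inv_cancel_right₀ (hne2 _)]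
    have hna : (-a).re = 0 := by rw [Quaternion.re_neg, ha, neg_zero]
    have hnc : (-c).re = 0 := by rw [Quaternion.re_neg, hc, neg_zero]
    have hna1 : Quaternion.normSq (-a) = 1 := by rwa [Quaternion.normSq_neg]
    have hnc1 : Quaternion.normSq (-c) = 1 := by rwa [Quaternion.normSq_neg]
    refine ⟨_, Or.inr ⟨_, _, isCircle_unitExp hre2 hn2 g1,
      isCircle_unitExp hnc hnc1 g2,
      unitExp_subset_sphere3 hna hna1 hre2 hn2 (map_one _),
      unitExp_subset_sphere3 hre1 hn1 hnc hnc1 hk1, rfl⟩, ?_⟩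
    rintro _ ⟨p, hp, rfl⟩
    obtain ⟨r, t, hr, hrt⟩ := exists_unitExp p.1
    obtain ⟨r', t', hr', hrt'⟩ := exists_unitExp p.2
    refine ⟨_, ⟨t, rfl⟩, _, ⟨t', rfl⟩, ?_⟩
    rw [hΦ p hp, hrt, hrt, hrt', hrt', inv_real_smul, inv_real_smul, inv_unitExp ha ha1,
      inv_unitExp hc hc1]
    simp only [smul_mul_assoc, mul_smul_comm, smul_smul, mul_one]
    rw [inv_mul_cancel₀ hr', one_mul, mul_inv_cancel₀ hr, one_smul]

/-! ### Polynomials of bidegree at most `(1, 1)` and regularity of `Φ`. -/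

/-- The coefficients of `1`, `u`, `v` and `uv`. -/
def bicoeff (P : HPoly) : Fin 4 → HH :=
  ![(P.coeff 0).coeff 0, (P.coeff 0).coeff 1, (P.coeff 1).coeff 0, (P.coeff 1).coeff 1]

theorem value_eq_comb {P : HPoly} (hP : P ∈ HDeg 1 1) (p : ℝ × ℝ) :
    value P p = comb (bicoeff P) (monomials p) := by
  obtain ⟨h1, h2⟩ := hP
  have hlin : ∀ Q : Polynomial HH, Q.natDegree ≤ 1 →
      Q.eval (p.1 : HH) = Q.coeff 0 + p.1 • Q.coeff 1 := fun Q hQ => by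
    rw [Polynomial.eval_eq_sum_range' (Nat.lt_succ_of_le hQ)]
    simp [Finset.sum_range_succ, Quaternion.mul_coe_eq_smul]
  rw [value, Polynomial.eval_eq_sum_range' (Nat.lt_succ_of_le h1)]
  simp only [Finset.sum_range_succ, Finset.range_zero, Finset.sum_empty, zero_add, pow_zero,
    mul_one, pow_one, Polynomial.eval_add]
  rw [hlin _ (h2 0), hlin _ ((Polynomial.natDegree_mul_C_le _ _).trans (h2 1)), comb_monomials]
  simp [bicoeff, Quaternion.mul_coe_eq_smul, smul_smul]
  abel

/-- If the product of two polynomials from `ℍ₁₁` is again in `ℍ₁₁`, then one of them is constant or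
they depend on one variable each. -/
theorem bicoeff_cases {A C : HPoly} (hA : A ∈ HDeg 1 1) (hC : C ∈ HDeg 1 1)
    (hAC : A * C ∈ HDeg 1 1) :
    (bicoeff A 1 = 0 ∧ bicoeff A 2 = 0 ∧ bicoeff A 3 = 0) ∨
    (bicoeff C 1 = 0 ∧ bicoeff C 2 = 0 ∧ bicoeff C 3 = 0) ∨
    (bicoeff A 2 = 0 ∧ bicoeff A 3 = 0 ∧ bicoeff C 1 = 0 ∧ bicoeff C 3 = 0) ∨
    (bicoeff A 1 = 0 ∧ bicoeff A 3 = 0 ∧ bicoeff C 2 = 0 ∧ bicoeff C 3 = 0) := by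
  have hu : ∀ j, ((A * C).coeff j).coeff 2 = 0 := fun j =>
    Polynomial.coeff_eq_zero_of_natDegree_lt (Nat.lt_succ_of_le (hAC.2 j))
  have hmul : ∀ i j, (A.coeff i * C.coeff j).coeff 2 = (A.coeff i).coeff 1 * (C.coeff j).coeff 1 :=
    fun i j => Polynomial.coeff_mul_add_eq_of_natDegree_le (df := 1) (dg := 1) (hA.2 i) (hC.2 j)
  have hv : A.coeff 1 * C.coeff 1 = 0 := by
    rw [← Polynomial.coeff_mul_add_eq_of_natDegree_le (df := 1) (dg := 1) hA.1 hC.1]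
    exact Polynomial.coeff_eq_zero_of_natDegree_lt (Nat.lt_succ_of_le hAC.1)
  have h0 : (A.coeff 0).coeff 1 * (C.coeff 0).coeff 1 = 0 := by
    rw [← hmul, ← Polynomial.mul_coeff_zero, hu]
  have h1 : (A.coeff 0).coeff 1 * (C.coeff 1).coeff 1
      + (A.coeff 1).coeff 1 * (C.coeff 0).coeff 1 = 0 := by
    rw [← hmul, ← hmul, ← Polynomial.coeff_add, ← Polynomial.mul_coeff_one, hu]
  simp only [bicoeff, Matrix.cons_val]
  -- The `v²`-term shows that `A` or `C` is free of `v`; the coefficients of `u²` and `u²v` then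
  -- decide the dependence on `u`.
  rcases mul_eq_zero.1 hv with hA1 | hC1
  · rw [hA1] at h1 ⊢
    simp only [Polynomial.coeff_zero, zero_mul, add_zero, mul_eq_zero] at h0 h1 ⊢
    tauto
  · rw [hC1] at h1 ⊢
    simp only [Polynomial.coeff_zero, mul_zero, zero_add, mul_eq_zero] at h0 h1 ⊢
    tauto

/-- A map depending on one coordinate only has zero derivative along the other. -/
theorem not_factor_through_coordinate {Φ : ℝ × ℝ → HH} {U : Set (ℝ × ℝ)} (hU : IsOpen U)
    (h : ∃ p ∈ U, Function.Injective (fderiv ℝ Φ p)) :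
    (¬ ∃ g : ℝ → HH, ∀ p ∈ U, Φ p = g p.1) ∧ ¬ ∃ g : ℝ → HH, ∀ p ∈ U, Φ p = g p.2 := by
  obtain ⟨p, hp, hinj⟩ := h
  have key : ∀ w : ℝ × ℝ, w ≠ 0 → ¬ ∀ t : ℝ, p + t • w ∈ U → Φ (p + t • w) = Φ p := by
    intro w hw hconst
    have hd : DifferentiableAt ℝ Φ p := by
      -- Without differentiability `fderiv` takes its default value zero, which is not injective.
      by_contra hnd
      rw [fderiv_zero_of_not_differentiableAt hnd] at hinj
      exact hw (hinj (by simp))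
    have hline : HasDerivAt (fun t : ℝ => p + t • w) w 0 := by
      simpa using ((hasDerivAt_id (0 : ℝ)).smul_const w).const_add p
    have h1 : HasDerivAt (fun t : ℝ => Φ (p + t • w)) (fderiv ℝ Φ p w) 0 := by
      refine HasFDerivAt.comp_hasDerivAt (0 : ℝ) (l := Φ) ?_ hline
      simpa using hd.hasFDerivAt
    have hev : (fun t : ℝ => Φ (p + t • w)) =ᶠ[nhds 0] fun _ => Φ p := by
      have : ∀ᶠ t : ℝ in nhds 0, p + t • w ∈ U :=
        hline.continuousAt.eventually_mem (hU.mem_nhds (by simpa using hp))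
      filter_upwards [this] with t ht using hconst t ht
    have h2 := (hasDerivAt_const (0 : ℝ) (Φ p)).congr_of_eventuallyEq hev
    exact hw (hinj (by rw [h1.unique h2, map_zero]))
  constructor
  · rintro ⟨g, hg⟩
    refine key (0, 1) (by simp) fun t ht => ?_
    rw [hg _ ht, hg _ hp]
    simp
  · rintro ⟨g, hg⟩
    refine key (1, 0) (by simp) fun t ht => ?_
    rw [hg _ ht, hg _ hp]
    simp

theorem comb_mul_mul (x y : HH) (b : Fin 4 → HH) (m : Fin 4 → ℝ) :
    comb (fun i => x * b i * y) m = x * comb b m * y := by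
  simp only [comb_apply, mul_add, add_mul, smul_mul_assoc, mul_smul_comm]

theorem exists_comb_affine (b : Fin 4 → HH) (k l s t : ℝ) : ∃ b' : Fin 4 → HH, ∀ p : ℝ × ℝ,
    comb b (monomials (k * p.1 + s, l * p.2 + t)) = comb b' (monomials p) := by
  refine ⟨![b 0 + s • b 1 + t • b 2 + (s * t) • b 3, k • b 1 + (k * t) • b 3,
    l • b 2 + (l * s) • b 3, (k * l) • b 3], fun p => ?_⟩
  simp only [comb_monomials, Matrix.cons_val]
  module

theorem exists_unit_imaginary {x : HH} (hx : x.im ≠ 0) : ∃ (k : ℝ) (a : HH), k ≠ 0 ∧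
    a.re = 0 ∧ Quaternion.normSq a = 1 ∧ x = (x.re : HH) + k • a := by
  have hn := norm_ne_zero_iff.2 hx
  refine ⟨‖x.im‖, ‖x.im‖⁻¹ • x.im, hn, by simp, ?_, ?_⟩
  · rw [Quaternion.normSq_smul, normSq_eq_norm_sq]
    field_simp
  · rw [smul_smul, mul_inv_cancel₀ hn, one_smul, Quaternion.re_add_im]

theorem eq_coe_of_im_eq_zero {x : HH} (hx : x.im = 0) : x = (x.re : HH) := by
  conv_lhs => rw [← Quaternion.re_add_im x, hx, add_zero]

/-! ### Reduction to one-sided fractions and normal forms, simultaneously for `ℝ³` and `S³`. -/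

section Reduction

variable {T : Set HH} {Good : Set HH → Prop}

/-- Reduction of the surfaces `A(u)⁻¹ B(u,v) C(v)⁻¹` to normal forms. -/
theorem reduction_separate
    (hL : ∀ {a b : Fin 4 → HH} {U : Set (ℝ × ℝ)}, IsOpen U → U.Nonempty → ∀ {Φ : ℝ × ℝ → HH},
      (∀ p ∈ U, comb a (monomials p) ≠ 0) →
      (∀ p ∈ U, comb a (monomials p) * Φ p = comb b (monomials p)) → Φ '' U ⊆ T → Good (Φ '' U))
    (hR : ∀ {b c : Fin 4 → HH} {U : Set (ℝ × ℝ)}, IsOpen U → U.Nonempty → ∀ {Φ : ℝ × ℝ → HH},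
      (∀ p ∈ U, comb c (monomials p) ≠ 0) →
      (∀ p ∈ U, Φ p * comb c (monomials p) = comb b (monomials p)) → Φ '' U ⊆ T → Good (Φ '' U))
    (hN : ∀ {a c : HH}, a.re = 0 → Quaternion.normSq a = 1 → c.re = 0 → Quaternion.normSq c = 1 →
      ∀ {b : Fin 4 → HH} {U : Set (ℝ × ℝ)}, IsOpen U → U.Nonempty → ∀ {Φ : ℝ × ℝ → HH},
      (∀ p ∈ U, Φ p = ((p.1 : HH) + a)⁻¹ * comb b (monomials p) * ((p.2 : HH) + c)⁻¹) →
      (¬ ∃ g : ℝ → HH, ∀ p ∈ U, Φ p = g p.1) → (¬ ∃ g : ℝ → HH, ∀ p ∈ U, Φ p = g p.2) →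
      Φ '' U ⊆ T → Good (Φ '' U))
    {a₀ a₁ c₀ c₂ : HH} {b : Fin 4 → HH} {U : Set (ℝ × ℝ)} (hU : IsOpen U) (hne : U.Nonempty)
    {Φ : ℝ × ℝ → HH} (hA : ∀ p ∈ U, a₀ + p.1 • a₁ ≠ 0) (hC : ∀ p ∈ U, c₀ + p.2 • c₂ ≠ 0)
    (h : ∀ p ∈ U, Φ p = (a₀ + p.1 • a₁)⁻¹ * comb b (monomials p) * (c₀ + p.2 • c₂)⁻¹)
    (hu : ¬ ∃ g : ℝ → HH, ∀ p ∈ U, Φ p = g p.1) (hv : ¬ ∃ g : ℝ → HH, ∀ p ∈ U, Φ p = g p.2)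
    (hS : Φ '' U ⊆ T) : Good (Φ '' U) := by
  have hleft : ∀ p ∈ U, (a₀ + p.1 • a₁) * Φ p = comb b (monomials p) * (c₀ + p.2 • c₂)⁻¹ :=
    fun p hp => by rw [h p hp, mul_assoc, mul_inv_cancel_left₀ (hA p hp)]
  have hright : ∀ p ∈ U, Φ p * (c₀ + p.2 • c₂) = (a₀ + p.1 • a₁)⁻¹ * comb b (monomials p) :=
    fun p hp => by rw [h p hp, inv_mul_cancel_right₀ (hC p hp)]
  by_cases ha₁ : a₁ = 0
  · have e : ∀ p, comb ![c₀, 0, c₂, 0] (monomials p) = c₀ + p.2 • c₂ := fun p => by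
      simp [comb_monomials]
    refine hR (b := fun i => a₀⁻¹ * b i * 1) (c := ![c₀, 0, c₂, 0]) hU hne (fun p hp => ?_)
      (fun p hp => ?_) hS
    · rw [e]
      exact hC p hp
    · rw [e, hright p hp, comb_mul_mul, ha₁, smul_zero, add_zero, mul_one]
  by_cases hc₂ : c₂ = 0
  · have e : ∀ p, comb ![a₀, a₁, 0, 0] (monomials p) = a₀ + p.1 • a₁ := fun p => by
      simp [comb_monomials]
    refine hL (b := fun i => 1 * b i * c₀⁻¹) (a := ![a₀, a₁, 0, 0]) hU hne (fun p hp => ?_)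
      (fun p hp => ?_) hS
    · rw [e]
      exact hA p hp
    · rw [e, hleft p hp, comb_mul_mul, hc₂, smul_zero, add_zero, one_mul]
  -- In this case `A = (r + u)a₁` with real `r`; the real factor is central and can be moved into
  -- `C`, which leaves a one-sided fraction. The case of `C` is symmetric.
  by_cases hα : (a₁⁻¹ * a₀).im = 0
  · obtain ⟨r, hr⟩ : ∃ r : ℝ, a₀ = r • a₁ := by
      refine ⟨(a₁⁻¹ * a₀).re, ?_⟩
      rw [← Quaternion.mul_coe_eq_smul, ← eq_coe_of_im_eq_zero hα, mul_inv_cancel_left₀ ha₁]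
    have e : ∀ p, comb ![r • c₀, c₀, r • c₂, c₂] (monomials p) =
        (r + p.1) • (c₀ + p.2 • c₂) := fun p => by
      simp only [comb_monomials, Matrix.cons_val]
      module
    have hA' : ∀ p ∈ U, r + p.1 ≠ 0 := fun p hp h0 => by
      apply hA p hp
      rw [hr, ← add_smul, h0, zero_smul]
    refine hR (b := fun i => a₁⁻¹ * b i * 1) (c := ![r • c₀, c₀, r • c₂, c₂]) hU hne
      (fun p hp => ?_) (fun p hp => ?_) hS
    · rw [e]
      exact smul_ne_zero (hA' p hp) (hC p hp)
    · rw [e, mul_smul_comm, hright p hp, comb_mul_mul, hr, ← add_smul, inv_real_smul,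
        smul_mul_assoc, smul_smul, mul_inv_cancel₀ (hA' p hp), one_smul, mul_one]
  by_cases hγ : (c₀ * c₂⁻¹).im = 0
  · obtain ⟨r, hr⟩ : ∃ r : ℝ, c₀ = r • c₂ := by
      refine ⟨(c₀ * c₂⁻¹).re, ?_⟩
      rw [← Quaternion.coe_mul_eq_smul, ← eq_coe_of_im_eq_zero hγ, inv_mul_cancel_right₀ hc₂]
    have e : ∀ p, comb ![r • a₀, r • a₁, a₀, a₁] (monomials p) =
        (r + p.2) • (a₀ + p.1 • a₁) := fun p => by
      simp only [comb_monomials, Matrix.cons_val]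
      module
    have hC' : ∀ p ∈ U, r + p.2 ≠ 0 := fun p hp h0 => by
      apply hC p hp
      rw [hr, ← add_smul, h0, zero_smul]
    refine hL (b := fun i => 1 * b i * c₂⁻¹) (a := ![r • a₀, r • a₁, a₀, a₁]) hU hne
      (fun p hp => ?_) (fun p hp => ?_) hS
    · rw [e]
      exact smul_ne_zero (hC' p hp) (hA p hp)
    · rw [e, smul_mul_assoc, hleft p hp, comb_mul_mul, hr, ← add_smul, inv_real_smul,
        mul_smul_comm, smul_smul, mul_inv_cancel₀ (hC' p hp), one_smul, one_mul]
  obtain ⟨k, a, hk, ha, ha1, hka⟩ := exists_unit_imaginary hα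
  obtain ⟨l, c, hl, hc, hc1, hlc⟩ := exists_unit_imaginary hγ
  generalize (a₁⁻¹ * a₀).re = s at hka
  generalize (c₀ * c₂⁻¹).re = t at hlc
  -- With `a₁⁻¹a₀ = s + ka`, replacing `u` by `ku - s` turns `a₀ + u a₁` into `k a₁(u + a)`, and
  -- similarly for `C`. The outer constants go into `B`.
  let L : ℝ × ℝ → ℝ × ℝ := fun p => (k * p.1 + -s, l * p.2 + -t)
  have hLc : Continuous L := by fun_prop
  have hLs : ∀ p : ℝ × ℝ, L ((p.1 + s) / k, (p.2 + t) / l) = p := fun p => by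
    ext
    · simp only [L]
      field_simp
      ring
    · simp only [L]
      field_simp
      ring
  have hsurj : Function.Surjective L := fun p => ⟨_, hLs p⟩
  have himg : Φ '' U = (Φ ∘ L) '' (L ⁻¹' U) := by
    rw [Set.image_comp, Set.image_preimage_eq _ hsurj]
  have hAL : ∀ u : ℝ, a₀ + (k * u + -s) • a₁ = a₁ * (k • ((u : HH) + a)) := fun u => by
    have : a₀ = a₁ * ((s : HH) + k • a) := by rw [← hka, mul_inv_cancel_left₀ ha₁]
    rw [this, mul_add, smul_add, mul_add, Quaternion.mul_coe_eq_smul, mul_smul_comm k a₁ (u : HH),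
      Quaternion.mul_coe_eq_smul]
    module
  have hCL : ∀ v : ℝ, c₀ + (l * v + -t) • c₂ = (l • ((v : HH) + c)) * c₂ := fun v => by
    have : c₀ = ((t : HH) + l • c) * c₂ := by rw [← hlc, inv_mul_cancel_right₀ hc₂]
    rw [this, add_mul, smul_add, add_mul, Quaternion.coe_mul_eq_smul, smul_mul_assoc l (v : HH),
      Quaternion.coe_mul_eq_smul]
    module
  obtain ⟨b', hb'⟩ := exists_comb_affine b k l (-s) (-t)
  rw [himg] at hS ⊢
  refine hN ha ha1 hc hc1 (b := fun i => (k⁻¹ • a₁⁻¹) * b' i * (l⁻¹ • c₂⁻¹))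
    (hU.preimage hLc) (hne.preimage hsurj) (fun p hp => ?_) ?_ ?_ hS
  · rw [Function.comp_apply, h _ hp, comb_mul_mul, ← hb', hAL, hCL, mul_inv_rev, mul_inv_rev,
      inv_real_smul, inv_real_smul]
    simp only [smul_mul_assoc, mul_smul_comm, mul_assoc]
    rfl
  · rintro ⟨g, hg⟩
    refine hu ⟨fun x => g ((x + s) / k), fun p hp => ?_⟩
    have := hg ((p.1 + s) / k, (p.2 + t) / l) (by rwa [Set.mem_preimage, hLs])
    rwa [Function.comp_apply, hLs] at this
  · rintro ⟨g, hg⟩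
    refine hv ⟨fun x => g ((x + t) / l), fun p hp => ?_⟩
    have := hg ((p.1 + s) / k, (p.2 + t) / l) (by rwa [Set.mem_preimage, hLs])
    rwa [Function.comp_apply, hLs] at this

/-- Reduction of the surfaces `A⁻¹ B C⁻¹` to normal forms. -/
theorem reduction
    (hL : ∀ {a b : Fin 4 → HH} {U : Set (ℝ × ℝ)}, IsOpen U → U.Nonempty → ∀ {Φ : ℝ × ℝ → HH},
      (∀ p ∈ U, comb a (monomials p) ≠ 0) →
      (∀ p ∈ U, comb a (monomials p) * Φ p = comb b (monomials p)) → Φ '' U ⊆ T → Good (Φ '' U))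
    (hR : ∀ {b c : Fin 4 → HH} {U : Set (ℝ × ℝ)}, IsOpen U → U.Nonempty → ∀ {Φ : ℝ × ℝ → HH},
      (∀ p ∈ U, comb c (monomials p) ≠ 0) →
      (∀ p ∈ U, Φ p * comb c (monomials p) = comb b (monomials p)) → Φ '' U ⊆ T → Good (Φ '' U))
    (hN : ∀ {a c : HH}, a.re = 0 → Quaternion.normSq a = 1 → c.re = 0 → Quaternion.normSq c = 1 →
      ∀ {b : Fin 4 → HH} {U : Set (ℝ × ℝ)}, IsOpen U → U.Nonempty → ∀ {Φ : ℝ × ℝ → HH},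
      (∀ p ∈ U, Φ p = ((p.1 : HH) + a)⁻¹ * comb b (monomials p) * ((p.2 : HH) + c)⁻¹) →
      (¬ ∃ g : ℝ → HH, ∀ p ∈ U, Φ p = g p.1) → (¬ ∃ g : ℝ → HH, ∀ p ∈ U, Φ p = g p.2) →
      Φ '' U ⊆ T → Good (Φ '' U))
    {A B C : HPoly} (hA : A ∈ HDeg 1 1) (hB : B ∈ HDeg 1 1) (hC : C ∈ HDeg 1 1)
    (hAC : A * C ∈ HDeg 1 1) {U : Set (ℝ × ℝ)} (hU : IsOpen U)
    (hdef : ∀ p ∈ U, value A p ≠ 0 ∧ value C p ≠ 0)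
    (hreg : ∃ p ∈ U, Function.Injective (fderiv ℝ (surfaceMap A B C) p))
    (hS : surfaceMap A B C '' U ⊆ T) : Good (surfaceMap A B C '' U) := by
  obtain ⟨hu, hv⟩ := not_factor_through_coordinate hU hreg
  obtain ⟨p₀, hp₀, -⟩ := hreg
  have hne : U.Nonempty := ⟨p₀, hp₀⟩
  have hΦ : ∀ p, surfaceMap A B C p = (comb (bicoeff A) (monomials p))⁻¹ *
      comb (bicoeff B) (monomials p) * (comb (bicoeff C) (monomials p))⁻¹ := fun p => by
    rw [surfaceMap, value_eq_comb hA, value_eq_comb hB, value_eq_comb hC]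
  have hA0 : ∀ p ∈ U, comb (bicoeff A) (monomials p) ≠ 0 := fun p hp => by
    rw [← value_eq_comb hA]
    exact (hdef p hp).1
  have hC0 : ∀ p ∈ U, comb (bicoeff C) (monomials p) ≠ 0 := fun p hp => by
    rw [← value_eq_comb hC]
    exact (hdef p hp).2
  rcases bicoeff_cases hA hC hAC with ⟨h1, h2, h3⟩ | ⟨h1, h2, h3⟩ | ⟨h1, h2, h3, h4⟩ |
    ⟨h1, h2, h3, h4⟩
  · have e : ∀ p, comb (bicoeff A) (monomials p) = bicoeff A 0 := fun p => by
      simp [comb_monomials, h1, h2, h3]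
    refine hR (b := fun i => (bicoeff A 0)⁻¹ * bicoeff B i * 1) (c := bicoeff C) hU hne hC0
      (fun p hp => ?_) hS
    rw [hΦ, e, inv_mul_cancel_right₀ (hC0 p hp), comb_mul_mul, mul_one]
  · have e : ∀ p, comb (bicoeff C) (monomials p) = bicoeff C 0 := fun p => by
      simp [comb_monomials, h1, h2, h3]
    refine hL (b := fun i => 1 * bicoeff B i * (bicoeff C 0)⁻¹) (a := bicoeff A) hU hne hA0
      (fun p hp => ?_) hS
    rw [hΦ, e, mul_assoc _⁻¹, mul_inv_cancel_left₀ (hA0 p hp), comb_mul_mul, one_mul]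
  · have eA : ∀ p, comb (bicoeff A) (monomials p) = bicoeff A 0 + p.1 • bicoeff A 1 := fun p => by
      simp [comb_monomials, h1, h2]
    have eC : ∀ p, comb (bicoeff C) (monomials p) = bicoeff C 0 + p.2 • bicoeff C 2 := fun p => by
      simp [comb_monomials, h3, h4]
    simp only [eA, eC] at hΦ hA0 hC0
    exact reduction_separate hL hR hN hU hne hA0 hC0 (fun p _ => hΦ p) hu hv hS
  · have eA : ∀ p, comb (bicoeff A) (monomials p) = bicoeff A 0 + p.2 • bicoeff A 2 := fun p => by
      simp [comb_monomials, h1, h2]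
    have eC : ∀ p, comb (bicoeff C) (monomials p) = bicoeff C 0 + p.1 • bicoeff C 1 := fun p => by
      simp [comb_monomials, h3, h4]
    simp only [eA, eC] at hΦ hA0 hC0
    -- Here `A` depends on `v` and `C` on `u`; exchanging the parameters restores the previous case.
    have himg : surfaceMap A B C '' U = (surfaceMap A B C ∘ Prod.swap) '' (Prod.swap ⁻¹' U) := by
      rw [Set.image_comp, Set.image_preimage_eq _ Prod.swap_surjective]
    rw [himg] at hS ⊢
    refine reduction_separate hL hR hN (hU.preimage continuous_swap)
      (hne.preimage Prod.swap_surjective) (fun p hp => hA0 _ hp) (fun p hp => hC0 _ hp)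
      (b := ![bicoeff B 0, bicoeff B 2, bicoeff B 1, bicoeff B 3]) (fun p _ => ?_) ?_ ?_ hS
    · rw [Function.comp_apply, hΦ]
      simp only [comb_monomials, Matrix.cons_val, Prod.fst_swap, Prod.snd_swap, mul_comm p.2 p.1]
      rw [add_right_comm (bicoeff B 0)]
    · rintro ⟨g, hg⟩
      exact hv ⟨g, fun p hp => by simpa using hg p.swap (by simpa using hp)⟩
    · rintro ⟨g, hg⟩
      exact hu ⟨g, fun p hp => by simpa using hg p.swap (by simpa using hp)⟩

end Reduction

end TwoCircles

end

/-- The surface is `Φ(U)` for an open set `U` of real parameters `(u,v)` on which `A⁻¹` and `C⁻¹`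
make sense; it is nondegenerate in the weak sense that the differential of `Φ` is injective at one
point of `U` at least (for an analytic surface this holds at every point). -/
theorem theorem1p3 (A B C : TwoCircles.HPoly)
    (hA : A ∈ TwoCircles.HDeg 1 1) (hB : B ∈ TwoCircles.HDeg 1 1) (hC : C ∈ TwoCircles.HDeg 1 1)
    (hAC : A * C ∈ TwoCircles.HDeg 1 1)
    (U : Set (ℝ × ℝ)) (hU : IsOpen U)
    (hdef : ∀ p ∈ U, TwoCircles.value A p ≠ 0 ∧ TwoCircles.value C p ≠ 0)
    (hreg : ∃ p ∈ U, Function.Injective (fderiv ℝ (TwoCircles.surfaceMap A B C) p)) :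
    (TwoCircles.surfaceMap A B C '' U ⊆ TwoCircles.imH →
      ∃ S : Set TwoCircles.HH,
        (TwoCircles.IsDarbouxCyclide S ∨ TwoCircles.IsEuclideanTranslational S) ∧
          TwoCircles.surfaceMap A B C '' U ⊆ S) ∧
    (TwoCircles.surfaceMap A B C '' U ⊆ TwoCircles.sphere3 →
      ∃ S : Set TwoCircles.HH,
        (TwoCircles.IsSphereQuadricSection S ∨ TwoCircles.IsCliffordTranslational S) ∧
          TwoCircles.surfaceMap A B C '' U ⊆ S) := by
  constructor
  · refine TwoCircles.reduction (T := TwoCircles.imH) (Good := fun V => ∃ S,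
      (TwoCircles.IsDarbouxCyclide S ∨ TwoCircles.IsEuclideanTranslational S) ∧ V ⊆ S)
      (fun hU hne _ hA h hS => ?_) (fun hU hne _ hC h hS => ?_)
      TwoCircles.exists_cyclide_or_translational hA hB hC hAC hU hdef hreg
    · obtain ⟨S, hS', hsub⟩ := TwoCircles.exists_cyclide_of_mul_eq hU hne hA h hS
      exact ⟨S, Or.inl hS', hsub⟩
    · obtain ⟨S, hS', hsub⟩ := TwoCircles.exists_cyclide_of_mul_eq' hU hne hC h hS
      exact ⟨S, Or.inl hS', hsub⟩
  · refine TwoCircles.reduction (T := TwoCircles.sphere3) (Good := fun V => ∃ S,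
      (TwoCircles.IsSphereQuadricSection S ∨ TwoCircles.IsCliffordTranslational S) ∧ V ⊆ S)
      (fun hU hne _ hA h hS => ?_) (fun hU hne _ hC h hS => ?_)
      TwoCircles.exists_section_or_translational hA hB hC hAC hU hdef hreg
    · obtain ⟨S, hS', hsub⟩ := (TwoCircles.inQuadric_of_mul_eq hU hne hA h hS).exists_section hS
      exact ⟨S, Or.inl hS', hsub⟩
    · obtain ⟨S, hS', hsub⟩ := (TwoCircles.inQuadric_of_mul_eq' hU hne hC h hS).exists_section hS
      exact ⟨S, Or.inl hS', hsub⟩
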